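/- Let $K=\mathbb{Q}(q)$ and let $n$ be a non-negative integer. Let $O_q(M(n))$ be the associative unital $K$-algebra generated by $Z_{ij}$, $1\le i,j\le n$, subject to the relations $$Z_{ij}Z_{ik}=q^2Z_{ik}Z_{ij}\ (j<k),\qquad Z_{ij}Z_{kj}=q^2Z_{kj}Z_{ij}\ (i<k),$$ $$Z_{ij}Z_{st}=Z_{st}Z_{ij}\ (i>s,\ j<t),\qquad Z_{ij}Z_{st}=Z_{st}Z_{ij}+(q^2-q^{-2})Z_{it}Z_{sj}\ (i<s,\ j<t).$$ Let $x\mapsto\overline{x}$ be the ring anti-automorphism of $O_q(M(n))$ with $\overline{Z_{ij}}=Z_{ij}$ and $\overline{q}=q^{-1}$. For an $n\times n$ matrix $A=(a_{ij})$ with entries in $\mathbb{Z}_+=\{0,1,2,\dots\}$ let $Z^A=\prod_{i,j}Z_{ij}^{a_{ij}}$, where the factors are arranged in the lexicographic order of the pairs $(i,j)$, let $$D(A)=q^{-\sum_i\sum_{j>k}a_{ij}a_{ik}-\sum_i\sum_{j>k}a_{ji}a_{ki}},\qquad Z(A)=D(A)Z^A,$$ and let $ro(A)\in\mathbb{Z}_+^n$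 and $co(A)\in\mathbb{Z}_+^n$ be the vectors of row sums and of column sums of $A$. Matrices are ordered lexicographically, their entries being read row by row. Theorem 3.2. The elements $Z(A)$, $A\in M_n(\mathbb{Z}_+)$, are linearly independent over $\mathbb{Z}[q]$; let $L^*=\bigoplus_{A\in M_n(\mathbb{Z}_+)}\mathbb{Z}[q]Z(A)$ be the $\mathbb{Z}[q]$-lattice that they span. There is a unique $\mathbb{Z}[q]$-basis $B^*=\{b(A)\mid A\in M_n(\mathbb{Z}_+)\}$ of $L^*$ such that for all $A$: (1) $\overline{b(A)}=b(A)$; (2) $b(A)=Z(A)+\sum_{B}h_B(A)Z(B)$, a finite sum over matrices $B\in M_n(\mathbb{Z}_+)$ with $B<A$, $ro(B)=ro(A)$ and $co(B)=co(A)$, where $h_B(A)\in q\mathbb{Z}[q]$. -/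

import Mathlib

noncomputable section

namespace QuantumMatrix

/-- The base field `K = ℚ(q)`. -/
abbrev K : Type := RatFunc ℚ

/-- The indeterminate `q`. -/
abbrev q : K := RatFunc.X

lemma transcendental_q_inv : Transcendental ℚ (q⁻¹ : K) := fun h => by
  have hX := RatFunc.transcendental_X (K := ℚ)
  have e : (RatFunc.instAlgebraOfPolynomial ℚ ℚ : Algebra ℚ K) = DivisionRing.toRatAlgebra :=
    Subsingleton.elim _ _
  rw [e] at hX
  exact hX (IsAlgebraic.inv_iff.mp h)

lemma evalInv_nonZeroDivisors :
    nonZeroDivisors (Polynomial ℚ) ≤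
      (nonZeroDivisors K).comap (Polynomial.aeval (R := ℚ) (q⁻¹ : K)).toRingHom :=
  nonZeroDivisors_le_comap_nonZeroDivisors_of_injective _
    (transcendental_iff_injective.mp transcendental_q_inv)

/-- The bar involution of `ℚ(q)`: the field homomorphism with `q ↦ q⁻¹`. -/
def barK : K →+* K :=
  RatFunc.liftRingHom (Polynomial.aeval (R := ℚ) (q⁻¹ : K)).toRingHom evalInv_nonZeroDivisors

lemma barK_q : barK q = q⁻¹ := by
  simp [barK]

/-- The ring `ℤ[q]`, as a subring of `ℚ(q)`. -/
abbrev Zq : Subalgebra ℤ K := Algebra.adjoin ℤ {q}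

/-- The generators of the free algebra on the symbols `Z_{ij}`. -/
abbrev gen {n : ℕ} (i j : Fin n) : FreeAlgebra K (Fin n × Fin n) := FreeAlgebra.ι K (i, j)

/-- The defining relations of the quantum matrix algebra. -/
inductive Rel (n : ℕ) :
    FreeAlgebra K (Fin n × Fin n) → FreeAlgebra K (Fin n × Fin n) → Prop
  | row (i j k : Fin n) (h : j < k) :
      Rel n (gen i j * gen i k) (q ^ 2 • (gen i k * gen i j))
  | col (i k j : Fin n) (h : i < k) :
      Rel n (gen i j * gen k j) (q ^ 2 • (gen k j * gen i j))
  | comm (i j s t : Fin n) (hi : s < i) (hj : j < t) :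
      Rel n (gen i j * gen s t) (gen s t * gen i j)
  | cross (i j s t : Fin n) (hi : i < s) (hj : j < t) :
      Rel n (gen i j * gen s t)
        (gen s t * gen i j + (q ^ 2 - (q ^ 2)⁻¹) • (gen i t * gen s j))

/-- The coordinate algebra `O_q(M(n))` of the quantum matrices. -/
def O (n : ℕ) : Type := RingQuot (Rel n)

instance (n : ℕ) : Ring (O n) := inferInstanceAs (Ring (RingQuot (Rel n)))

instance (n : ℕ) : Algebra K (O n) := inferInstanceAs (Algebra K (RingQuot (Rel n)))

/-- The quotient map from the free algebra onto `O_q(M(n))`. -/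
def toO (n : ℕ) : FreeAlgebra K (Fin n × Fin n) →ₐ[K] O n := RingQuot.mkAlgHom K (Rel n)

lemma toO_rel {n : ℕ} {x y : FreeAlgebra K (Fin n × Fin n)} (h : Rel n x y) :
    toO n x = toO n y := RingQuot.mkAlgHom_rel K h

/-- The generator `Z_{ij}` of `O_q(M(n))`. -/
def Z {n : ℕ} (i j : Fin n) : O n := toO n (gen i j)

lemma Z_row {n : ℕ} (i j k : Fin n) (h : j < k) :
    Z i j * Z i k = q ^ 2 • (Z i k * Z i j) := by
  simpa [Z] using toO_rel (Rel.row i j k h)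

lemma Z_col {n : ℕ} (i k j : Fin n) (h : i < k) :
    Z i j * Z k j = q ^ 2 • (Z k j * Z i j) := by
  simpa [Z] using toO_rel (Rel.col i k j h)

lemma Z_comm {n : ℕ} (i j s t : Fin n) (hi : s < i) (hj : j < t) :
    Z i j * Z s t = Z s t * Z i j := by
  simpa [Z] using toO_rel (Rel.comm i j s t hi hj)

lemma Z_cross {n : ℕ} (i j s t : Fin n) (hi : i < s) (hj : j < t) :
    Z i j * Z s t = Z s t * Z i j + (q ^ 2 - (q ^ 2)⁻¹) • (Z i t * Z s j) := by
  have := toO_rel (Rel.cross i j s t hi hj)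
  rw [map_add, map_smul, map_mul, map_mul, map_mul] at this
  exact this

/-- The opposite algebra of `O_q(M(n))`, with scalars acting through the bar involution of `K`. -/
def Obar (n : ℕ) : Type := (O n)ᵐᵒᵖ

instance (n : ℕ) : Ring (Obar n) := inferInstanceAs (Ring (O n)ᵐᵒᵖ)

instance (n : ℕ) : Algebra K (Obar n) :=
  RingHom.toAlgebra' ((algebraMap K (O n)ᵐᵒᵖ).comp barK)
    (fun c x => Algebra.commutes (A := (O n)ᵐᵒᵖ) (barK c) x)

/-- The passage from `O_q(M(n))` to its twisted opposite algebra, as an additive bijection. -/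
def toObar {n : ℕ} : O n ≃+ Obar n := MulOpposite.opAddEquiv

lemma toObar_mul {n : ℕ} (x y : O n) : toObar (x * y) = toObar y * toObar x := rfl

lemma toObar_smul {n : ℕ} (c : K) (x : O n) : toObar (barK c • x) = c • toObar x := by
  rw [Algebra.smul_def c (toObar x), Algebra.smul_def (barK c) x, Algebra.commutes]
  rfl

lemma Z_cross' {n : ℕ} (i j s t : Fin n) (hi : i < s) (hj : j < t) :
    Z s t * Z i j = Z i j * Z s t + barK (q ^ 2 - (q ^ 2)⁻¹) • (Z s j * Z i t) := by
  have hb : barK (q ^ 2 - (q ^ 2)⁻¹) = -(q ^ 2 - (q ^ 2)⁻¹) := by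
    simp [barK_q]
  rw [hb, Z_cross i j s t hi hj, Z_comm s j i t hi hj, add_assoc, ← add_smul, add_neg_cancel,
    zero_smul, add_zero]

lemma smul_barK_q_sq {n : ℕ} (x y : O n) (h : x = q ^ 2 • y) : y = barK (q ^ 2) • x := by
  have hq : (q : K) ≠ 0 := RatFunc.X_ne_zero
  rw [h, smul_smul, map_pow, barK_q, ← mul_pow, inv_mul_cancel₀ hq, one_pow, one_smul]

/-- The homomorphism from the free algebra to the twisted opposite of `O_q(M(n))` with
`Z_{ij} ↦ Z_{ij}`. -/
def freeBarHom (n : ℕ) : FreeAlgebra K (Fin n × Fin n) →ₐ[K] Obar n :=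
  FreeAlgebra.lift K (fun p => toObar (Z p.1 p.2))

lemma freeBarHom_gen {n : ℕ} (i j : Fin n) : freeBarHom n (gen i j) = toObar (Z i j) :=
  FreeAlgebra.lift_ι_apply _ _

lemma freeBarHom_rel {n : ℕ} {x y : FreeAlgebra K (Fin n × Fin n)} (h : Rel n x y) :
    freeBarHom n x = freeBarHom n y := by
  induction h with
  | row i j k h =>
    simp only [map_mul, map_smul, freeBarHom_gen, ← toObar_mul, ← toObar_smul]
    exact congrArg toObar (smul_barK_q_sq _ _ (Z_row i j k h))
  | col i k j h =>
    simp only [map_mul, map_smul, freeBarHom_gen, ← toObar_mul, ← toObar_smul]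
    exact congrArg toObar (smul_barK_q_sq _ _ (Z_col i k j h))
  | comm i j s t hi hj =>
    simp only [map_mul, freeBarHom_gen, ← toObar_mul]
    exact congrArg toObar (Z_comm i j s t hi hj).symm
  | cross i j s t hi hj =>
    rw [map_add, map_smul, map_mul, map_mul, map_mul]
    simp only [freeBarHom_gen, ← toObar_mul, ← toObar_smul, ← map_add]
    exact congrArg toObar (Z_cross' i j s t hi hj)

/-- The `K`-algebra homomorphism from `O_q(M(n))` to its twisted opposite with
`Z_{ij} ↦ Z_{ij}`. -/
def barHom (n : ℕ) : O n →ₐ[K] Obar n :=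
  RingQuot.liftAlgHom K ⟨freeBarHom n, fun _ _ h => freeBarHom_rel h⟩

lemma barHom_toO {n : ℕ} (x : FreeAlgebra K (Fin n × Fin n)) :
    barHom n (toO n x) = freeBarHom n x :=
  RingQuot.liftAlgHom_mkAlgHom_apply K _ _ _

/-- The bar anti-automorphism of `O_q(M(n))`: the ring anti-homomorphism
with `Z_{ij} ↦ Z_{ij}` and `q ↦ q⁻¹`. -/
def bar {n : ℕ} (x : O n) : O n := toObar.symm (barHom n x)

lemma bar_add {n : ℕ} (x y : O n) : bar (x + y) = bar x + bar y := by
  simp [bar]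

lemma bar_mul {n : ℕ} (x y : O n) : bar (x * y) = bar y * bar x := by
  unfold bar
  rw [map_mul]
  rfl

lemma bar_one {n : ℕ} : bar (1 : O n) = 1 := by
  unfold bar
  rw [map_one]
  rfl

lemma bar_smul {n : ℕ} (c : K) (x : O n) : bar (c • x) = barK c • bar x := by
  apply toObar.injective
  rw [toObar_smul]
  simp [bar]

lemma bar_Z {n : ℕ} (i j : Fin n) : bar (Z i j) = Z i j := by
  apply toObar.injective
  rw [bar, AddEquiv.apply_symm_apply, Z, barHom_toO, freeBarHom_gen]
  rfl

/-- The monomial `Z^A = ∏ Z_{ij}^{a_{ij}}`, the factors being arranged in the lexicographic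
order of the pairs `(i, j)`. -/
def monomial {n : ℕ} (A : Matrix (Fin n) (Fin n) ℕ) : O n :=
  ((List.finRange n).map fun i => ((List.finRange n).map fun j => Z i j ^ A i j).prod).prod

/-- The number `∑_i ∑_{j>k} a_{ij} a_{ik} + ∑_i ∑_{j>k} a_{ji} a_{ki}`. -/
def dExp {n : ℕ} (A : Matrix (Fin n) (Fin n) ℕ) : ℕ :=
  (∑ i, ∑ j, ∑ k ∈ Finset.univ.filter (fun k => k < j), A i j * A i k) +
    ∑ i, ∑ j, ∑ k ∈ Finset.univ.filter (fun k => k < j), A j i * A k i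

/-- The normalizing factor `D(A)`. -/
def D {n : ℕ} (A : Matrix (Fin n) (Fin n) ℕ) : K := q ^ (-(dExp A : ℤ))

/-- The normalized monomial `Z(A) = D(A) Z^A`. -/
def normMonomial {n : ℕ} (A : Matrix (Fin n) (Fin n) ℕ) : O n := D A • monomial A

/-- The `ℤ[q]`-lattice `L^*` spanned by the normalized monomials. -/
def lattice (n : ℕ) : Submodule Zq (O n) :=
  Submodule.span Zq (Set.range (normMonomial (n := n)))

/-- The row sums of a matrix. -/
def ro {n : ℕ} (A : Matrix (Fin n) (Fin n) ℕ) : Fin n → ℕ := fun i => ∑ j, A i j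

/-- The column sums of a matrix. -/
def co {n : ℕ} (A : Matrix (Fin n) (Fin n) ℕ) : Fin n → ℕ := fun j => ∑ i, A i j

/-- The word of entries of a matrix, read row by row, as an element of the
lexicographically ordered product. -/
def entries {n : ℕ} (A : Matrix (Fin n) (Fin n) ℕ) : Lex ((Fin n ×ₗ Fin n) → ℕ) :=
  toLex fun p => A (ofLex p).1 (ofLex p).2

/-- The strict lexicographic order on matrices. -/
def LexLT {n : ℕ} (B A : Matrix (Fin n) (Fin n) ℕ) : Prop := entries B < entries A

/-- The element `x` has the form `Z(A) + ∑_{B < A} h_B Z(B)`, a finite sum over matrices `B` with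
the row and column sums of `A`, with all `h_B` in `q ℤ[q]`. -/
def HasLeadingTerm {n : ℕ} (A : Matrix (Fin n) (Fin n) ℕ) (x : O n) : Prop :=
  ∃ h : Matrix (Fin n) (Fin n) ℕ →₀ K,
    (∀ B, ∃ p ∈ Zq, h B = q * p) ∧
    (∀ B ∈ h.support, LexLT B A ∧ ro B = ro A ∧ co B = co A) ∧
    x = normMonomial A + h.sum fun B c => c • normMonomial B

end QuantumMatrix

end

noncomputable section

namespace QuantumMatrix

/-! This is the Kazhdan–Lusztig scheme: a semilinear involution that is unitriangular on a basis,
for an order with finite lower sets, has exactly one invariant basis that agrees with the given one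
modulo lower terms with coefficients in qℤ[q]. Two facts about quantum matrices feed it.

Independence of the ordered monomials (`linearIndependent_monomial`). A representation is built in
which the ordered monomials send one vector to independent vectors. Products of quantum matrices
with mutually commuting entries are quantum (`ColRel.comb`), so the block matrix diag(1, X) may be
multiplied by 2 × 2 matrices of q-oscillators. This adds a row to X whose entries raise exponents,
and the claim follows by induction on the number of rows.

Triangularity of bar (`bar_normMonomial_sub_mem`). After each word is scaled by q to minus its
energy, exchanging two neighbouring letters costs at most a term in which Z_ab Z_cd (a < c, b < d)
is traded for Z_ad Z_cb. This keeps row and column sums and lowers the exponent matrix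
lexicographically. Bar reverses words, energy changes sign under reversal, and D(A) is exactly the
scaling of the sorted word; hence bar fixes Z(A) up to Laurent combinations of lower monomials.

An anti-invariant Laurent polynomial is g − bar g with g in qℤ[q] (`exists_eq_sub_barK`). Peeling
off largest matrices therefore solves for the invariant element (`exists_eq_comb_sub_bar`), and
qℤ[q] ∩ ℤ[q⁻¹] = 0 gives uniqueness (`eq_zero_of_bar_comb`). -/

/-- An element commutes with all entries of a column. -/
def CommCol {R ι : Type*} [Ring R] (x : R) (u : ι → R) : Prop := ∀ i, Commute x (u i)

lemma mul_comb {R : Type*} [Ring R] {x k y l a b e f : R} (hya : Commute y a)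
    (hyb : Commute y b) (hla : Commute l a) (hlb : Commute l b) : (x * a + k * b) * (y * e + l * f) =
      x * y * (a * e) + x * l * (a * f) + k * y * (b * e) + k * l * (b * f) := by
  rw [add_mul, mul_add, mul_add, hya.symm.mul_mul_mul_comm, hla.symm.mul_mul_mul_comm,
    hyb.symm.mul_mul_mul_comm, hlb.symm.mul_mul_mul_comm]
  abel

/-! ### Quantum matrices and combinations of their columns -/

section Relations

variable {F R ι J : Type*} [Field F] [Ring R] [Algebra F R] [LinearOrder ι] [LinearOrder J]

/-- The relations among the entries of one column of a quantum matrix with parameter `r`. -/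
def ColSelf (r : F) (u : ι → R) : Prop :=
  ∀ i s, i < s → u i * u s = r • (u s * u i)

/-- The relations between the entries of a column `u` of a quantum matrix and the entries of a
column `v` to the right of it. -/
structure ColRel (r : F) (u v : ι → R) : Prop where
  row : ∀ i, u i * v i = r • (v i * u i)
  comm : ∀ i s, i < s → v i * u s = u s * v i
  cross : ∀ i s, i < s → u i * v s = v s * u i + (r - r⁻¹) • (u s * v i)

/-- The entries of `X` satisfy the relations of quantum matrices with parameter `r`. -/
structure IsQuantum (r : F) (X : ι → J → R) : Prop where
  self : ∀ j, ColSelf r (fun i => X i j)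
  rel : ∀ j k, j < k → ColRel r (fun i => X i j) (fun i => X i k)

/-- The relations are linear in the left column, so coefficients commuting with the right column
pass through; no relation between `x` and `k` enters. -/
lemma ColRel.comb_left {r : F} {u u' v : ι → R} {x k : R} (hu : ColRel r u v)
    (hu' : ColRel r u' v) (hx : CommCol x v) (hk : CommCol k v) :
    ColRel r (fun i => x * u i + k * u' i) v where
  row i := by
    rw [add_mul, mul_add, mul_assoc, mul_assoc, hu.row, hu'.row, ← mul_assoc (v i) x,
      ← mul_assoc (v i) k, ← (hx i).eq, ← (hk i).eq]
    simp only [mul_smul_comm, mul_assoc, smul_add]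
  comm i s h := by
    rw [add_mul, mul_add, ← mul_assoc (v i) x, ← mul_assoc (v i) k, ← (hx i).eq, ← (hk i).eq,
      mul_assoc, mul_assoc, hu.comm i s h, hu'.comm i s h, mul_assoc, mul_assoc]
  cross i s h := by
    rw [add_mul, mul_add, add_mul, ← mul_assoc (v s) x, ← mul_assoc (v s) k, ← (hx s).eq,
      ← (hk s).eq, mul_assoc, mul_assoc, hu.cross i s h, hu'.cross i s h]
    simp only [mul_smul_comm, mul_assoc, smul_add, mul_add]
    abel

lemma ColRel.comb_right {r : F} {u v v' : ι → R} {x k : R} (hv : ColRel r u v)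
    (hv' : ColRel r u v') (hx : CommCol x u) (hk : CommCol k u) :
    ColRel r u (fun i => x * v i + k * v' i) where
  row i := by
    rw [add_mul, mul_add, ← mul_assoc (u i) x, ← mul_assoc (u i) k, ← (hx i).eq, ← (hk i).eq,
      mul_assoc, mul_assoc, hv.row, hv'.row]
    simp only [mul_smul_comm, mul_assoc, smul_add]
  comm i s h := by
    rw [add_mul, mul_add, ← mul_assoc (u s) x, ← mul_assoc (u s) k, ← (hx s).eq, ← (hk s).eq,
      mul_assoc, mul_assoc, hv.comm i s h, hv'.comm i s h, mul_assoc, mul_assoc]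
  cross i s h := by
    rw [add_mul, mul_add, mul_add, ← mul_assoc (u i) x, ← mul_assoc (u i) k, ← (hx i).eq,
      ← (hk i).eq, mul_assoc, mul_assoc, hv.cross i s h, hv'.cross i s h,
      ← mul_assoc (u s) x, ← mul_assoc (u s) k, ← (hx s).eq, ← (hk s).eq]
    simp only [mul_smul_comm, mul_assoc, smul_add, mul_add]
    abel

lemma ColSelf.comb {r : F} (hr : r ≠ 0) {u v : ι → R} {x k : R} (hu : ColSelf r u)
    (hv : ColSelf r v) (huv : ColRel r u v) (hxu : CommCol x u) (hxv : CommCol x v)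
    (hku : CommCol k u) (hkv : CommCol k v) (hxk : x * k = r • (k * x)) :
    ColSelf r (fun i => x * u i + k * v i) := by
  intro i s h
  simp only
  rw [mul_comb (hxu i) (hxv i) (hku i) (hkv i), mul_comb (hxu s) (hxv s) (hku s) (hkv s),
    hxk, hu i s h, hv i s h, huv.comm i s h, huv.cross i s h]
  simp only [mul_add, smul_add, mul_smul_comm, smul_mul_assoc, smul_smul]
  match_scalars <;> field_simp; ring

/-- The relations of a `2 × 2` quantum matrix with rows `(x, y)` and `(k, l)`. -/
structure IsQuantumTwo (r : F) (x y k l : R) : Prop where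
  row₁ : x * y = r • (y * x)
  row₂ : k * l = r • (l * k)
  col₁ : x * k = r • (k * x)
  col₂ : y * l = r • (l * y)
  comm : y * k = k * y
  cross : x * l = l * x + (r - r⁻¹) • (k * y)

/-- Multiplicativity of quantum matrices, for the two columns (u, v) times T with rows (x, y) and
(k, l). Since T commutes with the columns, both factors can be brought to normal order separately,
and the coefficients then agree. -/
lemma ColRel.comb {r : F} (hr : r ≠ 0) {u v : ι → R} {x y k l : R} (hu : ColSelf r u)
    (hv : ColSelf r v) (huv : ColRel r u v) (hT : IsQuantumTwo r x y k l)
    (hxu : CommCol x u) (hxv : CommCol x v) (hyu : CommCol y u) (hyv : CommCol y v)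
    (hku : CommCol k u) (hkv : CommCol k v) (hlu : CommCol l u) (hlv : CommCol l v) :
    ColRel r (fun i => x * u i + k * v i) (fun i => y * u i + l * v i) where
  row i := by
    rw [mul_comb (hyu i) (hyv i) (hlu i) (hlv i), mul_comb (hxu i) (hxv i) (hku i) (hkv i),
      hT.row₁, hT.row₂, hT.comm, hT.cross, huv.row i]
    simp only [add_mul, smul_add, mul_smul_comm, smul_mul_assoc, smul_smul]
    match_scalars <;> field_simp; ring
  comm i s h := by
    rw [mul_comb (hxu i) (hxv i) (hku i) (hkv i), mul_comb (hyu s) (hyv s) (hlu s) (hlv s),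
      hT.row₁, hT.row₂, hT.comm, hT.cross, hu i s h, hv i s h, huv.comm i s h, huv.cross i s h]
    simp only [mul_add, add_mul, mul_smul_comm, smul_mul_assoc]
    match_scalars <;> field_simp
  cross i s h := by
    rw [mul_comb (hyu i) (hyv i) (hlu i) (hlv i), mul_comb (hxu s) (hxv s) (hku s) (hkv s),
      mul_comb (hyu s) (hyv s) (hlu s) (hlv s),
      hT.row₁, hT.row₂, hT.comm, hT.cross, hu i s h, hv i s h, huv.comm i s h, huv.cross i s h]
    simp only [mul_add, add_mul, smul_add, mul_smul_comm, smul_mul_assoc, smul_smul]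
    match_scalars <;> field_simp <;> ring

end Relations

/-! ### Multiplication by 2 × 2 blocks on neighbouring columns -/

section Mixing

variable {F R ι : Type*} [Field F] [Ring R] [Algebra F R] [LinearOrder ι]

/-- The product of a matrix with a `2 × 2` matrix acting on the columns `t` and `t + 1`. -/
def mixCol {ι R : Type*} [Ring R] {n : ℕ} (x y k l : R) (t : Fin n) (X : ι → Fin (n + 1) → R) :
    ι → Fin (n + 1) → R := fun i j =>
  if j = t.castSucc then x * X i t.castSucc + k * X i t.succ
  else if j = t.succ then y * X i t.castSucc + l * X i t.succ else X i j

lemma mixCol_castSucc {ι R : Type*} [Ring R] {n : ℕ} (x y k l : R) (t : Fin n)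
    (X : ι → Fin (n + 1) → R) (i : ι) :
    mixCol x y k l t X i t.castSucc = x * X i t.castSucc + k * X i t.succ := by
  simp [mixCol]

lemma mixCol_succ {ι R : Type*} [Ring R] {n : ℕ} (x y k l : R) (t : Fin n)
    (X : ι → Fin (n + 1) → R) (i : ι) :
    mixCol x y k l t X i t.succ = y * X i t.castSucc + l * X i t.succ := by
  have : t.succ ≠ t.castSucc := (Fin.castSucc_lt_succ).ne'
  simp [mixCol, this]

lemma mixCol_of_ne {ι R : Type*} [Ring R] {n : ℕ} (x y k l : R) (t : Fin n)
    (X : ι → Fin (n + 1) → R) (i : ι) {j : Fin (n + 1)} (h : j ≠ t.castSucc) (h' : j ≠ t.succ) :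
    mixCol x y k l t X i j = X i j := by
  simp [mixCol, h, h']

lemma commute_mixCol {ι R : Type*} [Ring R] {n : ℕ} {x y k l z : R} {t : Fin n}
    {X : ι → Fin (n + 1) → R} (hx : Commute z x) (hy : Commute z y) (hk : Commute z k)
    (hl : Commute z l) (h : ∀ i j, Commute z (X i j)) (i : ι) (j : Fin (n + 1)) :
    Commute z (mixCol x y k l t X i j) := by
  unfold mixCol
  split_ifs
  · exact (hx.mul_right (h _ _)).add_right (hk.mul_right (h _ _))
  · exact (hy.mul_right (h _ _)).add_right (hl.mul_right (h _ _))
  · exact h _ _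

/-- The mixed columns are neighbours, so any other column lies on the same side of both and the
linear cases `comb_left` and `comb_right` apply to it. -/
lemma IsQuantum.mixCol {r : F} (hr : r ≠ 0) {n : ℕ} {x y k l : R} {t : Fin n}
    {X : ι → Fin (n + 1) → R} (hX : IsQuantum r X) (hT : IsQuantumTwo r x y k l)
    (hx : ∀ i j, Commute x (X i j)) (hy : ∀ i j, Commute y (X i j))
    (hk : ∀ i j, Commute k (X i j)) (hl : ∀ i j, Commute l (X i j)) :
    IsQuantum r (mixCol x y k l t X) := by
  have hlt : t.castSucc < t.succ := Fin.castSucc_lt_succ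
  constructor
  · intro j
    rcases eq_or_ne j t.castSucc with rfl | h
    · simp only [mixCol_castSucc]
      exact ColSelf.comb hr (hX.self _) (hX.self _) (hX.rel _ _ hlt) (fun i => hx i _)
        (fun i => hx i _) (fun i => hk i _) (fun i => hk i _) hT.col₁
    rcases eq_or_ne j t.succ with rfl | h'
    · simp only [mixCol_succ]
      exact ColSelf.comb hr (hX.self _) (hX.self _) (hX.rel _ _ hlt) (fun i => hy i _)
        (fun i => hy i _) (fun i => hl i _) (fun i => hl i _) hT.col₂
    simp only [mixCol_of_ne x y k l t X _ h h']
    exact hX.self j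
  · intro i j hij
    rcases eq_or_ne i t.castSucc with rfl | h
    · rcases eq_or_ne j t.succ with rfl | h'
      · simp only [mixCol_castSucc, mixCol_succ]
        exact ColRel.comb hr (hX.self _) (hX.self _) (hX.rel _ _ hlt) hT (fun i => hx i _)
          (fun i => hx i _) (fun i => hy i _) (fun i => hy i _) (fun i => hk i _)
          (fun i => hk i _) (fun i => hl i _) (fun i => hl i _)
      · simp only [mixCol_castSucc, mixCol_of_ne x y k l t X _ hij.ne' h']
        have : t.succ < j := lt_of_le_of_ne (Fin.castSucc_lt_iff_succ_le.mp hij) h'.symm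
        exact (hX.rel _ _ hij).comb_left (hX.rel _ _ this) (fun i => hx i _) (fun i => hk i _)
    rcases eq_or_ne i t.succ with rfl | h'
    · have hj : j ≠ t.castSucc := (hlt.trans hij).ne'
      simp only [mixCol_succ, mixCol_of_ne x y k l t X _ hj hij.ne']
      exact (hX.rel _ _ (hlt.trans hij)).comb_left (hX.rel _ _ hij) (fun i => hy i _)
        (fun i => hl i _)
    simp only [mixCol_of_ne x y k l t X _ h h']
    rcases eq_or_ne j t.castSucc with rfl | g
    · simp only [mixCol_castSucc]
      exact (hX.rel _ _ hij).comb_right (hX.rel _ _ (hij.trans hlt)) (fun i => hx i _)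
        (fun i => hk i _)
    rcases eq_or_ne j t.succ with rfl | g'
    · simp only [mixCol_succ]
      have : i < t.castSucc := lt_of_le_of_ne (Fin.le_castSucc_iff.mpr hij) h
      exact (hX.rel _ _ this).comb_right (hX.rel _ _ hij) (fun i => hy i _)
        (fun i => hl i _)
    simp only [mixCol_of_ne x y k l t X _ g g']
    exact hX.rel _ _ hij

/-- The product of a matrix with the `2 × 2` matrices acting on the pairs of neighbouring columns
to the left of the column `t`. -/
def mixUpTo {ι R : Type*} [Ring R] {n : ℕ} (x y k l : Fin n → R) (X : ι → Fin (n + 1) → R)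
    (t : Fin (n + 1)) : ι → Fin (n + 1) → R :=
  Fin.induction X (fun t Y => mixCol (x t) (y t) (k t) (l t) t Y) t

lemma mixUpTo_zero {ι R : Type*} [Ring R] {n : ℕ} (x y k l : Fin n → R)
    (X : ι → Fin (n + 1) → R) : mixUpTo x y k l X 0 = X := rfl

lemma mixUpTo_succ {ι R : Type*} [Ring R] {n : ℕ} (x y k l : Fin n → R)
    (X : ι → Fin (n + 1) → R) (t : Fin n) : mixUpTo x y k l X t.succ =
      mixCol (x t) (y t) (k t) (l t) t (mixUpTo x y k l X t.castSucc) := rfl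

lemma commute_mixUpTo {ι R : Type*} [Ring R] {n : ℕ} {x y k l : Fin n → R}
    {X : ι → Fin (n + 1) → R} {z : R} (h : ∀ i j, Commute z (X i j)) (t : Fin (n + 1))
    (hz : ∀ u : Fin n, u.castSucc < t →
      Commute z (x u) ∧ Commute z (y u) ∧ Commute z (k u) ∧ Commute z (l u))
    (i : ι) (j : Fin (n + 1)) : Commute z (mixUpTo x y k l X t i j) := by
  induction t using Fin.induction generalizing i j with
  | zero => exact h i j
  | succ t ih =>
    rw [mixUpTo_succ]
    obtain ⟨h₁, h₂, h₃, h₄⟩ := hz t Fin.castSucc_lt_succ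
    exact commute_mixCol h₁ h₂ h₃ h₄
      (ih fun u hu => hz u (hu.trans Fin.castSucc_lt_succ)) i j

lemma IsQuantum.mixUpTo {r : F} (hr : r ≠ 0) {n : ℕ} {x y k l : Fin n → R}
    {X : ι → Fin (n + 1) → R} (hX : IsQuantum r X)
    (hT : ∀ t, IsQuantumTwo r (x t) (y t) (k t) (l t))
    (hx : ∀ t i j, Commute (x t) (X i j)) (hy : ∀ t i j, Commute (y t) (X i j))
    (hk : ∀ t i j, Commute (k t) (X i j)) (hl : ∀ t i j, Commute (l t) (X i j))
    (hc : ∀ t, ∀ z ∈ ({x t, y t, k t, l t} : Set R), ∀ u, u ≠ t →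
      Commute z (x u) ∧ Commute z (y u) ∧ Commute z (k u) ∧ Commute z (l u))
    (t : Fin (n + 1)) : IsQuantum r (mixUpTo x y k l X t) := by
  induction t using Fin.induction with
  | zero => exact hX
  | succ t ih =>
    rw [mixUpTo_succ]
    have hne : ∀ u : Fin n, u.castSucc < t.castSucc → u ≠ t := fun u hu h => by simp [h] at hu
    exact ih.mixCol hr (hT t)
      (commute_mixUpTo (hx t) _ fun u hu => hc t _ (by simp) u (hne u hu))
      (commute_mixUpTo (hy t) _ fun u hu => hc t _ (by simp) u (hne u hu))
      (commute_mixUpTo (hk t) _ fun u hu => hc t _ (by simp) u (hne u hu))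
      (commute_mixUpTo (hl t) _ fun u hu => hc t _ (by simp) u (hne u hu))

/-- The block diagonal matrix with blocks `1` and `X`. -/
def corner {R : Type*} [Ring R] {m n : ℕ} (X : Fin m → Fin n → R) :
    Fin (m + 1) → Fin (n + 1) → R :=
  Fin.cons (Fin.cons 1 0) fun i => Fin.cons 0 (X i)

/-- In a relation involving the new row or column, each product has a zero factor, or the relation
says that 1 commutes with an entry. -/
lemma IsQuantum.corner {r : F} {m n : ℕ} {X : Fin m → Fin n → R} (hX : IsQuantum r X) :
    IsQuantum r (corner X) := by
  constructor
  · intro j i s h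
    obtain ⟨s, rfl⟩ := Fin.exists_succ_eq.mpr (Fin.ne_zero_of_lt h)
    cases j using Fin.cases <;> cases i using Fin.cases <;> simp [QuantumMatrix.corner]
    exact hX.self _ _ _ (Fin.succ_lt_succ_iff.mp h)
  · intro j k h
    obtain ⟨k, rfl⟩ := Fin.exists_succ_eq.mpr (Fin.ne_zero_of_lt h)
    constructor
    · intro i
      cases j using Fin.cases <;> cases i using Fin.cases <;> simp [QuantumMatrix.corner]
      exact (hX.rel _ _ (Fin.succ_lt_succ_iff.mp h)).row _
    · intro i s hs
      obtain ⟨s, rfl⟩ := Fin.exists_succ_eq.mpr (Fin.ne_zero_of_lt hs)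
      cases j using Fin.cases <;> cases i using Fin.cases <;> simp [QuantumMatrix.corner]
      exact (hX.rel _ _ (Fin.succ_lt_succ_iff.mp h)).comm _ _ (Fin.succ_lt_succ_iff.mp hs)
    · intro i s hs
      obtain ⟨s, rfl⟩ := Fin.exists_succ_eq.mpr (Fin.ne_zero_of_lt hs)
      cases j using Fin.cases <;> cases i using Fin.cases <;> simp [QuantumMatrix.corner]
      exact (hX.rel _ _ (Fin.succ_lt_succ_iff.mp h)).cross _ _ (Fin.succ_lt_succ_iff.mp hs)

lemma IsQuantum.map {S J : Type*} [LinearOrder J] [Ring S] [Algebra F S] {r : F} {X : ι → J → R}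
    (hX : IsQuantum r X) (f : R →ₐ[F] S) : IsQuantum r fun i j => f (X i j) := by
  constructor
  · intro j i s h
    simpa using congrArg f (hX.self j i s h)
  · intro j k h
    refine ⟨fun i => ?_, fun i s hs => ?_, fun i s hs => ?_⟩
    · simpa using congrArg f ((hX.rel j k h).row i)
    · simpa using congrArg f ((hX.rel j k h).comm i s hs)
    · simpa using congrArg f ((hX.rel j k h).cross i s hs)

end Mixing

/-! ### The oscillator representation and the added row -/

section Oscillator

variable {F M : Type*} [Field F] [AddCommGroup M] [Module F M] {n : ℕ}

/-- The operator `m e_a ↦ g(a_t) m e_{a + s ε_t}` on `M[ℤⁿ]`. -/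
def osc (t : Fin n) (g : ℤ → F) (s : ℤ) : Module.End F ((Fin n → ℤ) →₀ M) :=
  Finsupp.lsum F fun a => g (a t) • Finsupp.lsingle (a + Pi.single t s)

lemma osc_single (t : Fin n) (g : ℤ → F) (s : ℤ) (a : Fin n → ℤ) (m : M) :
    osc t g s (Finsupp.single a m) = Finsupp.single (a + Pi.single t s) (g (a t) • m) := by
  simp [osc]

lemma osc_mul (t : Fin n) (g g' : ℤ → F) (s s' : ℤ) :
    (osc t g s * osc t g' s' : Module.End F ((Fin n → ℤ) →₀ M)) =
      osc t (fun z => g (z + s') * g' z) (s' + s) := by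
  refine Finsupp.lhom_ext fun a m => ?_
  simp [osc_single, smul_smul, add_assoc, Pi.single_add]

lemma osc_smul (t : Fin n) (c : F) (g : ℤ → F) (s : ℤ) :
    (c • osc t g s : Module.End F ((Fin n → ℤ) →₀ M)) = osc t (fun z => c * g z) s := by
  refine Finsupp.lhom_ext fun a m => ?_
  simp [osc_single, smul_smul]

lemma osc_add (t : Fin n) (g g' : ℤ → F) (s : ℤ) :
    (osc t g s + osc t g' s : Module.End F ((Fin n → ℤ) →₀ M)) =
      osc t (fun z => g z + g' z) s := by
  refine Finsupp.lhom_ext fun a m => ?_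
  simp [osc_single, add_smul]

lemma osc_commute {t u : Fin n} (h : u ≠ t) (g g' : ℤ → F) (s s' : ℤ) :
    Commute (osc t g s : Module.End F ((Fin n → ℤ) →₀ M)) (osc u g' s') := by
  refine Finsupp.lhom_ext fun a m => ?_
  simp [osc_single, smul_smul, Pi.single_eq_of_ne h, Pi.single_eq_of_ne h.symm, mul_comm,
    add_right_comm]

/-- The raising operator. -/
def oscUp (t : Fin n) : Module.End F ((Fin n → ℤ) →₀ M) := osc t (fun _ => 1) 1

/-- The diagonal operator `r^{-a_t}`. -/
def oscDiag (r : F) (t : Fin n) : Module.End F ((Fin n → ℤ) →₀ M) := osc t (fun z => r ^ (-z)) 0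

/-- The lowering operator, which annihilates the vectors with `a_t = 0`. -/
def oscDown (r : F) (t : Fin n) : Module.End F ((Fin n → ℤ) →₀ M) :=
  osc t (fun z => r * r ^ (-z) * r ^ (-z) - r) (-1)

/-- The cross relation asks for a lowering coefficient g with g(z) − g(z + 1) = (r − r⁻¹) r^(−2z).
Its solutions include r^(1−2z) plus any constant, and the constant −r makes g vanish at z = 0. -/
lemma isQuantumTwo_osc {r : F} (hr : r ≠ 0) (t : Fin n) :
    IsQuantumTwo r (oscUp t : Module.End F ((Fin n → ℤ) →₀ M)) (oscDiag r t) (oscDiag r t)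
      (oscDown r t) := by
  constructor
  case cross =>
    simp only [oscUp, oscDiag, oscDown, osc_mul, osc_smul, add_zero, add_neg_cancel,
      neg_add_cancel, osc_add]
    congr 1
    ext z
    simp only [neg_add, zpow_add₀ hr]
    simp
    field_simp
    ring
  case comm => rfl
  all_goals
    simp only [oscUp, oscDiag, oscDown, osc_mul, osc_smul]
    congr 1 with z
    simp only [neg_add, zpow_add₀ hr]
    simp
    field_simp

/-- The action of the operators of `M` on the coefficients. -/
def liftEnd (F M : Type*) [Field F] [AddCommGroup M] [Module F M] (n : ℕ) :
    Module.End F M →ₐ[F] Module.End F ((Fin n → ℤ) →₀ M) where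
  toFun f := Finsupp.mapRange.linearMap f
  map_one' := Finsupp.mapRange.linearMap_id
  map_mul' f g := Finsupp.mapRange.linearMap_comp f g
  map_zero' := by
    refine Finsupp.lhom_ext fun a m => ?_
    simp
  map_add' f g := by
    refine Finsupp.lhom_ext fun a m => ?_
    simp
  commutes' c := by
    refine Finsupp.lhom_ext fun a m => ?_
    simp [Algebra.algebraMap_eq_smul_one]

lemma liftEnd_single (f : Module.End F M) (a : Fin n → ℤ) (m : M) :
    liftEnd F M n f (Finsupp.single a m) = Finsupp.single a (f m) := by
  simp [liftEnd]

lemma osc_commute_liftEnd (t : Fin n) (g : ℤ → F) (s : ℤ) (f : Module.End F M) :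
    Commute (osc t g s) (liftEnd F M n f) := by
  refine Finsupp.lhom_ext fun a m => ?_
  simp [osc_single, liftEnd_single]

lemma osc_commute_corner {m : ℕ} (t : Fin n) (g : ℤ → F) (s : ℤ)
    (X : Fin m → Fin n → Module.End F M) (i : Fin (m + 1)) (j : Fin (n + 1)) :
    Commute (osc t g s) (corner (fun i j => liftEnd F M n (X i j)) i j) := by
  cases i using Fin.cases <;> cases j using Fin.cases <;> simp [corner]
  exact osc_commute_liftEnd _ _ _ _

/-- The matrices obtained from the block diagonal matrix with blocks `1` and `X` by mixing
neighbouring columns with oscillators. -/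
def oscMix (r : F) {m : ℕ} (X : Fin m → Fin n → Module.End F M) (t : Fin (n + 1)) :
    Fin (m + 1) → Fin (n + 1) → Module.End F ((Fin n → ℤ) →₀ M) :=
  mixUpTo oscUp (oscDiag r) (oscDiag r) (oscDown r) (corner fun i j => liftEnd F M n (X i j)) t

lemma IsQuantum.oscMix {r : F} (hr : r ≠ 0) {m : ℕ} {X : Fin m → Fin n → Module.End F M}
    (hX : IsQuantum r X) (t : Fin (n + 1)) : IsQuantum r (oscMix r X t) := by
  refine IsQuantum.mixUpTo hr (hX.map _).corner (isQuantumTwo_osc hr)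
    (fun t => osc_commute_corner t _ _ X) (fun t => osc_commute_corner t _ _ X)
    (fun t => osc_commute_corner t _ _ X) (fun t => osc_commute_corner t _ _ X) ?_ t
  intro t z hz u hu
  rcases hz with rfl | rfl | rfl | rfl <;>
    exact ⟨osc_commute hu _ _ _ _, osc_commute hu _ _ _ _, osc_commute hu _ _ _ _,
      osc_commute hu _ _ _ _⟩

lemma oscDiag_single_zero (r : F) (t : Fin n) (m : M) :
    oscDiag r t (Finsupp.single 0 m) = Finsupp.single 0 m := by
  simp [oscDiag, osc_single]

lemma oscDown_single_zero (r : F) (t : Fin n) (m : M) :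
    oscDown r t (Finsupp.single 0 m) = 0 := by
  simp [oscDown, osc_single]

/-- Over the exponent 0 the diagonal operators act as the identity and the lowering operators as 0.
Each mixing step thus only moves the zero column one place to the right, past an entry of `X`. -/
lemma oscMix_succ_single (r : F) {m : ℕ} (X : Fin m → Fin n → Module.End F M) (s : Fin m) (v : M)
    (t : Fin (n + 1)) :
    (∀ j : Fin n, j.castSucc < t →
      oscMix r X t s.succ j.castSucc (Finsupp.single 0 v) = Finsupp.single 0 (X s j v)) ∧
    oscMix r X t s.succ t (Finsupp.single 0 v) = 0 ∧
    ∀ j : Fin n, t ≤ j.castSucc →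
      oscMix r X t s.succ j.succ (Finsupp.single 0 v) = Finsupp.single 0 (X s j v) := by
  induction t using Fin.induction with
  | zero => simp [oscMix, mixUpTo_zero, corner, liftEnd_single]
  | succ t ih =>
    obtain ⟨h₁, h₂, h₃⟩ := ih
    have h₃' := h₃ t le_rfl
    refine ⟨fun j hj => ?_, ?_, fun j hj => ?_⟩ <;> rw [oscMix, mixUpTo_succ, ← oscMix]
    · rcases eq_or_ne j t with rfl | hjt
      · simp [mixCol_castSucc, h₂, h₃', oscDiag_single_zero]
      · have hlt : j.castSucc < t.castSucc :=
          lt_of_le_of_ne (Fin.le_castSucc_iff.mpr hj) (by simpa using hjt)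
        rw [mixCol_of_ne _ _ _ _ _ _ _ hlt.ne hj.ne, h₁ j hlt]
    · simp [mixCol_succ, h₂, h₃', oscDown_single_zero]
    · have hlt : t.castSucc < j.castSucc := Fin.castSucc_lt_succ.trans_le hj
      have hjt : t.succ < j.succ := hj.trans_lt Fin.castSucc_lt_succ
      rw [mixCol_of_ne _ _ _ _ _ _ _ (Fin.castSucc_lt_succ.trans hjt).ne' hjt.ne', h₃ j hlt.le]

/-- The top row starts as (1, 0, …, 0). Step `t` splits its last nonzero entry into a raising
operator, left at `t`, and an invertible diagonal factor, passed on to `t + 1`. All exponents `a`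
are needed because the entries of this row are applied one after another. -/
lemma oscMix_zero_single {r : F} (hr : r ≠ 0) {m : ℕ} (X : Fin m → Fin n → Module.End F M)
    (t : Fin (n + 1)) :
    (∀ j : Fin n, j.castSucc < t → ∀ a, ∃ c : F, c ≠ 0 ∧ ∀ v,
      oscMix r X t 0 j.castSucc (Finsupp.single a v) =
        Finsupp.single (a + Pi.single j 1) (c • v)) ∧
    (∀ a, ∃ c : F, c ≠ 0 ∧ ∀ v,
      oscMix r X t 0 t (Finsupp.single a v) = Finsupp.single a (c • v)) ∧
    ∀ j : Fin n, t ≤ j.castSucc → oscMix r X t 0 j.succ = 0 := by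
  induction t using Fin.induction with
  | zero =>
    refine ⟨by simp, fun a => ⟨1, one_ne_zero, ?_⟩, ?_⟩ <;> simp [oscMix, mixUpTo_zero, corner]
  | succ t ih =>
    obtain ⟨h₁, h₂, h₃⟩ := ih
    have h₃' := h₃ t le_rfl
    refine ⟨fun j hj a => ?_, fun a => ?_, fun j hj => ?_⟩ <;>
      rw [oscMix, mixUpTo_succ, ← oscMix]
    · rcases eq_or_ne j t with rfl | hjt
      · obtain ⟨c, hc, h⟩ := h₂ a
        refine ⟨c, hc, fun v => ?_⟩
        simp [mixCol_castSucc, h, h₃', oscUp, osc_single]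
      · have hlt : j.castSucc < t.castSucc :=
          lt_of_le_of_ne (Fin.le_castSucc_iff.mpr hj) (by simpa using hjt)
        rw [mixCol_of_ne _ _ _ _ _ _ _ hlt.ne hj.ne]
        exact h₁ j hlt a
    · obtain ⟨c, hc, h⟩ := h₂ a
      refine ⟨r ^ (-a t) * c, mul_ne_zero (zpow_ne_zero _ hr) hc, fun v => ?_⟩
      simp [mixCol_succ, h, h₃', oscDiag, osc_single, smul_smul]
    · have hlt : t.castSucc < j.castSucc := Fin.castSucc_lt_succ.trans_le hj
      have hjt : t.succ < j.succ := hj.trans_lt Fin.castSucc_lt_succ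
      rw [mixCol_of_ne _ _ _ _ _ _ _ (Fin.castSucc_lt_succ.trans hjt).ne' hjt.ne', h₃ j hlt.le]

/-- The quantum matrix with one more row than `X`. -/
def addRow (r : F) {m : ℕ} (X : Fin m → Fin n → Module.End F M) :
    Fin (m + 1) → Fin n → Module.End F ((Fin n → ℤ) →₀ M) :=
  -- The column `Fin.last n`, which ends up with the leftover of the mixing, is discarded.
  fun i j => oscMix r X (Fin.last n) i j.castSucc

lemma IsQuantum.addRow {r : F} (hr : r ≠ 0) {m : ℕ} {X : Fin m → Fin n → Module.End F M}
    (hX : IsQuantum r X) : IsQuantum r (addRow r X) :=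
  ⟨fun _ => (hX.oscMix hr _).self _,
    fun _ _ h => (hX.oscMix hr _).rel _ _ (Fin.castSucc_lt_castSucc_iff.mpr h)⟩

lemma addRow_succ_single (r : F) {m : ℕ} (X : Fin m → Fin n → Module.End F M) (s : Fin m)
    (j : Fin n) (v : M) :
    addRow r X s.succ j (Finsupp.single 0 v) = Finsupp.single 0 (X s j v) :=
  (oscMix_succ_single r X s v _).1 j (Fin.castSucc_lt_last j)

lemma addRow_zero_single {r : F} (hr : r ≠ 0) {m : ℕ} (X : Fin m → Fin n → Module.End F M)
    (j : Fin n) (a : Fin n → ℤ) : ∃ c : F, c ≠ 0 ∧ ∀ v,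
      addRow r X 0 j (Finsupp.single a v) = Finsupp.single (a + Pi.single j 1) (c • v) :=
  (oscMix_zero_single hr X _).1 j (Fin.castSucc_lt_last j) a

end Oscillator

/-! ### Linear independence of the ordered monomials -/

/-- The ordered monomial in the entries of `X` with exponents `A`. -/
def ordProd {R : Type*} [Ring R] {m n : ℕ} (X : Fin m → Fin n → R) (A : Fin m → Fin n → ℕ) : R :=
  ((List.finRange m).map fun i => ((List.finRange n).map fun j => X i j ^ A i j).prod).prod

lemma ordProd_succ {R : Type*} [Ring R] {m n : ℕ} (X : Fin (m + 1) → Fin n → R)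
    (A : Fin (m + 1) → Fin n → ℕ) : ordProd X A =
      ((List.finRange n).map fun j => X 0 j ^ A 0 j).prod *
        ordProd (fun i => X i.succ) fun i => A i.succ := by
  simp [ordProd, List.finRange_succ, Function.comp_def]

section

variable {F M : Type*} [Field F] [AddCommGroup M] [Module F M] {n : ℕ}

lemma intertwine_list_prod {M' : Type*} [AddCommGroup M'] [Module F M'] {α : Type*} (l : List α)
    (f : α → Module.End F M') (g : α → Module.End F M) (e : M → M')
    (h : ∀ x v, f x (e v) = e (g x v)) (v : M) :
    (l.map f).prod (e v) = e ((l.map g).prod v) := by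
  induction l with
  | nil => simp
  | cons x l ih => simp [ih, h]

lemma intertwine_pow {M' : Type*} [AddCommGroup M'] [Module F M'] (f : Module.End F M')
    (g : Module.End F M) (e : M → M') (h : ∀ v, f (e v) = e (g v)) (k : ℕ) (v : M) :
    (f ^ k) (e v) = e ((g ^ k) v) := by
  induction k with
  | zero => simp
  | succ k ih => rw [pow_succ', pow_succ', Module.End.mul_apply, Module.End.mul_apply, ih, h]

lemma ordProd_addRow_single (r : F) {m : ℕ} (X : Fin m → Fin n → Module.End F M)
    (A : Fin m → Fin n → ℕ) (v : M) :
    ordProd (fun i => addRow r X i.succ) A (Finsupp.single 0 v) =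
      Finsupp.single 0 (ordProd X A v) := by
  refine intertwine_list_prod _ _ _ (Finsupp.single 0) (fun i v => ?_) v
  refine intertwine_list_prod _ _ _ (Finsupp.single 0) (fun j v => ?_) v
  exact intertwine_pow _ _ (Finsupp.single 0) (fun v => addRow_succ_single r X i j v) _ v

lemma addRow_zero_pow_single {r : F} (hr : r ≠ 0) {m : ℕ} (X : Fin m → Fin n → Module.End F M)
    (j : Fin n) (k : ℕ) (a : Fin n → ℤ) : ∃ c : F, c ≠ 0 ∧ ∀ v,
      (addRow r X 0 j ^ k) (Finsupp.single a v) =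
        Finsupp.single (a + Pi.single j (k : ℤ)) (c • v) := by
  induction k with
  | zero => exact ⟨1, one_ne_zero, by simp⟩
  | succ k ih =>
    obtain ⟨c, hc, h⟩ := ih
    obtain ⟨d, hd, h'⟩ := addRow_zero_single hr X j (a + Pi.single j (k : ℤ))
    refine ⟨d * c, mul_ne_zero hd hc, fun v => ?_⟩
    rw [pow_succ', Module.End.mul_apply, h, h', smul_smul, add_assoc, ← Pi.single_add]
    norm_cast

lemma addRow_zero_list_prod_single {r : F} (hr : r ≠ 0) {m : ℕ}
    (X : Fin m → Fin n → Module.End F M) (A : Fin n → ℕ) (l : List (Fin n)) (a : Fin n → ℤ) :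
    ∃ c : F, c ≠ 0 ∧ ∀ v,
      (l.map fun j => addRow r X 0 j ^ A j).prod (Finsupp.single a v) =
        Finsupp.single (a + (l.map fun j => Pi.single j (A j : ℤ)).sum) (c • v) := by
  induction l with
  | nil => exact ⟨1, one_ne_zero, by simp⟩
  | cons j l ih =>
    obtain ⟨c, hc, h⟩ := ih
    obtain ⟨d, hd, h'⟩ := addRow_zero_pow_single hr X j (A j)
      (a + (l.map fun j => Pi.single j (A j : ℤ)).sum)
    refine ⟨d * c, mul_ne_zero hd hc, fun v => ?_⟩
    simp only [List.map_cons, List.prod_cons, List.sum_cons, Module.End.mul_apply, h, h',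
      smul_smul]
    congr 1
    abel

lemma addRow_zero_prod_single {r : F} (hr : r ≠ 0) {m : ℕ}
    (X : Fin m → Fin n → Module.End F M) (A : Fin n → ℕ) :
    ∃ c : F, c ≠ 0 ∧ ∀ v,
      ((List.finRange n).map fun j => addRow r X 0 j ^ A j).prod (Finsupp.single 0 v) =
        Finsupp.single (fun j => (A j : ℤ)) (c • v) := by
  obtain ⟨c, hc, h⟩ := addRow_zero_list_prod_single hr X A (List.finRange n) 0
  refine ⟨c, hc, fun v => ?_⟩
  rw [h, zero_add, ← List.ofFn_eq_map, List.sum_ofFn,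
    Finset.univ_sum_single fun j => (A j : ℤ)]

end

/-- There is a quantum matrix of operators and a vector to which the ordered monomials can be
applied with linearly independent results. -/
lemma exists_isQuantum_linearIndependent (r : K) (hr : r ≠ 0) (n m : ℕ) :
    ∃ (M : Type) (_ : AddCommGroup M) (_ : Module K M) (X : Fin m → Fin n → Module.End K M)
      (v : M), IsQuantum r X ∧ LinearIndependent K fun A : Fin m → Fin n → ℕ => ordProd X A v := by
  induction m with
  | zero =>
    refine ⟨K, inferInstance, inferInstance, Fin.elim0, 1,
      ⟨fun _ i => i.elim0, fun _ _ _ => ⟨fun i => i.elim0, fun i => i.elim0, fun i => i.elim0⟩⟩, ?_⟩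
    rw [linearIndependent_unique_iff]
    simp [ordProd]
  | succ m ih =>
    obtain ⟨M, _, _, X, v, hX, hv⟩ := ih
    refine ⟨(Fin n → ℤ) →₀ M, Finsupp.instAddCommGroup, Finsupp.module _ _, addRow r X,
      Finsupp.single 0 v, hX.addRow hr, ?_⟩
    choose c hc h using fun A : Fin n → ℕ => addRow_zero_prod_single hr X A
    -- The lower rows act over the exponent 0, and the top row then moves the result to the exponent
    -- given by the first row of `A`. Different first rows land over different exponents; equal ones
    -- are separated by `hv`.
    have key := Finsupp.linearIndependent_single (R := K)
      (fun (_ : Fin n → ℤ) (B : Fin m → Fin n → ℕ) => ordProd X B v) fun _ => hv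
    let e : (Fin (m + 1) → Fin n → ℕ) → Σ _ : Fin n → ℤ, Fin m → Fin n → ℕ :=
      fun A => ⟨fun j => (A 0 j : ℤ), fun i => A i.succ⟩
    have he : Function.Injective e := by
      intro A B hAB
      simp only [e, Sigma.mk.injEq, heq_eq_eq] at hAB
      refine funext fun i => ?_
      cases i using Fin.cases with
      | zero => exact funext fun j => by exact_mod_cast congrFun hAB.1 j
      | succ i => exact congrFun hAB.2 i
    let w : (Fin (m + 1) → Fin n → ℕ) → Kˣ := fun A => Units.mk0 (c (A 0)) (hc _)
    have key := (key.comp e he).units_smul w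
    have hmul (A : Fin (m + 1) → Fin n → ℕ) :
        (w • (fun ix : Σ _ : Fin n → ℤ, Fin m → Fin n → ℕ =>
            Finsupp.single ix.1 (ordProd X ix.2 v)) ∘ e) A =
        ordProd (addRow r X) A (Finsupp.single 0 v) := by
      rw [ordProd_succ, Module.End.mul_apply, ordProd_addRow_single, h]
      simp [e, w, Units.smul_def]
    rw [funext hmul] at key
    exact key

lemma IsQuantum.rel_eq {M : Type*} [AddCommGroup M] [Module K M] {n : ℕ}
    {X : Fin n → Fin n → Module.End K M} (hX : IsQuantum (q ^ 2) X)
    {x y : FreeAlgebra K (Fin n × Fin n)} (h : Rel n x y) :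
    FreeAlgebra.lift K (fun p => X p.1 p.2) x = FreeAlgebra.lift K (fun p => X p.1 p.2) y := by
  induction h with
  | row i j k h => simpa using (hX.rel j k h).row i
  | col i k j h => simpa using hX.self j i k h
  | comm i j s t hi hj => simpa using (hX.rel j t hj).comm s i hi |>.symm
  | cross i j s t hi hj =>
    have := (hX.rel j t hj).cross i s hi
    -- The two cross relations list the factors of the correction term in opposite orders.
    have := (hX.rel j t hj).comm i s hi
    simp_all

/-- A quantum matrix of operators defines a representation of `O_q(M(n))`. -/
def rep {M : Type*} [AddCommGroup M] [Module K M] {n : ℕ}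
    {X : Fin n → Fin n → Module.End K M} (hX : IsQuantum (q ^ 2) X) : O n →ₐ[K] Module.End K M :=
  RingQuot.liftAlgHom K ⟨FreeAlgebra.lift K fun p => X p.1 p.2, fun _ _ h => hX.rel_eq h⟩

lemma rep_Z {M : Type*} [AddCommGroup M] [Module K M] {n : ℕ}
    {X : Fin n → Fin n → Module.End K M} (hX : IsQuantum (q ^ 2) X) (i j : Fin n) :
    rep hX (Z i j) = X i j := by
  have := RingQuot.liftAlgHom_mkAlgHom_apply K (FreeAlgebra.lift K fun p => X p.1 p.2)
    (fun _ _ h => hX.rel_eq h) (gen i j)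
  rw [FreeAlgebra.lift_ι_apply] at this
  exact this

lemma rep_monomial {M : Type*} [AddCommGroup M] [Module K M] {n : ℕ}
    {X : Fin n → Fin n → Module.End K M} (hX : IsQuantum (q ^ 2) X)
    (A : Matrix (Fin n) (Fin n) ℕ) : rep hX (monomial A) = ordProd X A := by
  simp [monomial, ordProd, map_list_prod, Function.comp_def, rep_Z]

lemma q_ne_zero : (q : K) ≠ 0 := RatFunc.X_ne_zero

theorem linearIndependent_monomial (n : ℕ) : LinearIndependent K (monomial (n := n)) := by
  obtain ⟨M, _, _, X, v, hX, hv⟩ :=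
    exists_isQuantum_linearIndependent (q ^ 2) (pow_ne_zero 2 q_ne_zero) n n
  refine LinearIndependent.of_comp
    ((LinearMap.applyₗ v : Module.End K M →ₗ[K] M).comp (rep hX).toLinearMap) ?_
  have h (A : Matrix (Fin n) (Fin n) ℕ) : rep hX (monomial A) v = ordProd X A v :=
    congrArg (fun f : Module.End K M => f v) (rep_monomial hX A)
  change LinearIndependent K fun A : Matrix (Fin n) (Fin n) ℕ => rep hX (monomial A) v
  rw [funext h]
  exact hv

theorem linearIndependent_normMonomial (n : ℕ) :
    LinearIndependent K (normMonomial (n := n)) :=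
  (linearIndependent_monomial n).units_smul fun A =>
    Units.mk0 (D A) (zpow_ne_zero _ q_ne_zero)

variable {n : ℕ}

/-! ### Words, their contents and the exchange relation -/

/-- The product of the generators along a word. -/
def wordProd (l : List (Fin n × Fin n)) : O n := (l.map fun p => Z p.1 p.2).prod

lemma wordProd_append (l l' : List (Fin n × Fin n)) :
    wordProd (l ++ l') = wordProd l * wordProd l' := by
  simp [wordProd]

lemma wordProd_cons (p : Fin n × Fin n) (l : List (Fin n × Fin n)) :
    wordProd (p :: l) = Z p.1 p.2 * wordProd l := by
  simp [wordProd]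

/-- The matrix of the multiplicities of the generators in a word. -/
def content (l : List (Fin n × Fin n)) : Matrix (Fin n) (Fin n) ℕ := fun i j => l.count (i, j)

lemma content_perm {l l' : List (Fin n × Fin n)} (h : l.Perm l') : content l = content l' :=
  funext fun _ => funext fun _ => h.count_eq _

lemma ro_content (l : List (Fin n × Fin n)) :
    ro (content l) = fun i => (l.map Prod.fst).count i := by
  funext i
  induction l with
  | nil => simp [ro, content]
  | cons p l ih =>
    simp only [ro, content, List.count_cons, List.map_cons, Finset.sum_add_distrib] at ih ⊢
    rw [ih]
    congr 1
    obtain ⟨a, b⟩ := p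
    by_cases h : a = i <;> simp [h]

lemma co_content (l : List (Fin n × Fin n)) :
    co (content l) = fun j => (l.map Prod.snd).count j := by
  funext j
  induction l with
  | nil => simp [co, content]
  | cons p l ih =>
    simp only [co, content, List.count_cons, List.map_cons, Finset.sum_add_distrib] at ih ⊢
    rw [ih]
    congr 1
    obtain ⟨a, b⟩ := p
    by_cases h : b = j <;> simp [h]

/-- The strict partial order on matrices: `B` is lexicographically smaller than `A` and has the same
row and column sums. -/
def Prec (B A : Matrix (Fin n) (Fin n) ℕ) : Prop := LexLT B A ∧ ro B = ro A ∧ co B = co A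

lemma Prec.trans {A B C : Matrix (Fin n) (Fin n) ℕ} (h : Prec A B) (h' : Prec B C) : Prec A C :=
  ⟨lt_trans h.1 h'.1, h.2.1.trans h'.2.1, h.2.2.trans h'.2.2⟩

lemma not_prec_self (A : Matrix (Fin n) (Fin n) ℕ) : ¬ Prec A A := fun h => lt_irrefl _ h.1

/-- The entries of `B` are bounded by the row sums of `A`. -/
lemma finite_prec (A : Matrix (Fin n) (Fin n) ℕ) : {B | Prec B A}.Finite := by
  have h : {B : Fin n → Fin n → ℕ | ∀ i j, B i j ∈ Set.Iic (ro A i)}.Finite := by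
    have := Set.Finite.pi' fun i : Fin n => Set.Finite.pi' fun _ : Fin n => Set.finite_Iic (ro A i)
    exact this
  refine h.subset fun B hB i j => ?_
  rw [← hB.2.1]
  exact Finset.single_le_sum (f := fun j => B i j) (fun _ _ => Nat.zero_le _) (Finset.mem_univ j)

lemma wellFounded_prec : WellFounded (Prec (n := n)) :=
  Subrelation.wf (fun h => h.1) (InvImage.wf entries wellFounded_lt)

/-- The first position in reading order at which the contents differ is (a, b), where the
multiplicity drops by one. -/
lemma prec_exchange {a b c d : Fin n} (h : a < c) (h' : b < d) (l l' : List (Fin n × Fin n)) :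
    Prec (content (l ++ (a, d) :: (c, b) :: l')) (content (l ++ (a, b) :: (c, d) :: l')) := by
  refine ⟨?_, ?_, ?_⟩
  · refine ⟨toLex (a, b), fun p hp => ?_, ?_⟩
    · have h₁ : ∀ x y : Fin n, a ≤ x → (x = a → b ≤ y) → (x, y) ≠ ofLex p := by
        rintro x y hx hxy he
        have : p = toLex (x, y) := by rw [he]; rfl
        rw [this, Prod.Lex.toLex_lt_toLex] at hp
        rcases hp with hp | hp
        · exact absurd hx (not_le.mpr hp)
        · exact absurd (hxy hp.1) (not_le.mpr hp.2)
      have h₂ := h₁ a b le_rfl (fun _ => le_rfl)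
      have h₃ := h₁ a d le_rfl (fun _ => h'.le)
      have h₄ := h₁ c b h.le (fun _ => le_rfl)
      have h₅ := h₁ c d h.le (fun _ => h'.le)
      simp [entries, content, h₂, h₃, h₄, h₅, List.count_cons]
    · simp [entries, content, h.ne', h'.ne', List.count_cons]
  · rw [ro_content, ro_content]
    simp
  · rw [co_content, co_content]
    funext j
    simp only [List.map_append, List.map_cons]
    exact (((List.Perm.swap _ _ _).append_left _).count_eq _)

/-- The ring `ℤ[q, q⁻¹]`, as a subring of `ℚ(q)`. -/
abbrev Laurent : Subalgebra ℤ K := Algebra.adjoin ℤ {q, q⁻¹}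

lemma q_mem_laurent : (q : K) ∈ Laurent := Algebra.subset_adjoin (by simp)

lemma q_inv_mem_laurent : (q : K)⁻¹ ∈ Laurent := Algebra.subset_adjoin (by simp)

lemma q_zpow_mem_laurent (k : ℤ) : (q : K) ^ k ∈ Laurent := by
  cases k with
  | ofNat k => simpa using pow_mem q_mem_laurent k
  | negSucc k =>
    rw [zpow_negSucc, ← inv_pow]
    exact pow_mem q_inv_mem_laurent _

/-- The exponent `k` in the relation `Z_p Z_{p'} = q^{2k} Z_{p'} Z_p + ⋯`. -/
def wt (p p' : Fin n × Fin n) : ℤ :=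
  if p.1 = p'.1 ∨ p.2 = p'.2 then
    if toLex p < toLex p' then 1 else if toLex p' < toLex p then -1 else 0
  else 0

lemma wt_antisymm (p p' : Fin n × Fin n) : wt p p' = -wt p' p := by
  unfold wt
  simp only [eq_comm (a := p.1), eq_comm (a := p.2)]
  rcases lt_trichotomy (toLex p) (toLex p') with h | h | h <;> simp [h, h.not_gt] <;>
    split_ifs <;> simp

/-- The weights cancel the q-commutation within a row or column. A correction survives only if the
two positions are in diagonal position, in either order, and its letters are the other two corners
of the rectangle. -/
lemma exchange (p p' : Fin n × Fin n) : ∃ c ∈ Laurent,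
    q ^ (-wt p p') • (Z p.1 p.2 * Z p'.1 p'.2) - q ^ (-wt p' p) • (Z p'.1 p'.2 * Z p.1 p.2) =
      c • (Z p.1 p'.2 * Z p'.1 p.2) ∧
    (c = 0 ∨ (p.1 < p'.1 ∧ p.2 < p'.2) ∨ (p'.1 < p.1 ∧ p'.2 < p.2)) := by
  obtain ⟨a, b⟩ := p
  obtain ⟨c, d⟩ := p'
  have hq := q_ne_zero
  have hq2 : (q : K) ^ 2 - (q ^ 2)⁻¹ ∈ Laurent := by
    rw [← inv_pow]
    exact sub_mem (pow_mem q_mem_laurent 2) (pow_mem q_inv_mem_laurent 2)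
  have hr : ∀ x y : O n, x = q ^ 2 • y → q ^ (-1 : ℤ) • x - q ^ (1 : ℤ) • y = 0 := by
    rintro x y rfl
    rw [smul_smul, ← sub_smul, zpow_neg_one, zpow_one, pow_two, inv_mul_cancel_left₀ hq, sub_self,
      zero_smul]
  rcases lt_trichotomy a c with h | rfl | h <;> rcases lt_trichotomy b d with h' | rfl | h'
  · refine ⟨_, hq2, ?_, Or.inr (Or.inl ⟨h, h'⟩)⟩
    simp [wt, h.ne, h.ne', h'.ne, h'.ne', Z_cross a b c d h h']
  · refine ⟨0, zero_mem _, ?_, Or.inl rfl⟩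
    simpa [wt, Prod.Lex.toLex_lt_toLex, h, h.not_gt, h.ne, h.ne'] using
      hr _ _ (Z_col a c b h)
  · refine ⟨0, zero_mem _, ?_, Or.inl rfl⟩
    simp [wt, h.ne, h.ne', h'.ne, h'.ne', Z_comm c d a b h h']
  · refine ⟨0, zero_mem _, ?_, Or.inl rfl⟩
    simpa [wt, Prod.Lex.toLex_lt_toLex, h', h'.not_gt] using hr _ _ (Z_row a b d h')
  · refine ⟨0, zero_mem _, ?_, Or.inl rfl⟩
    simp
  · refine ⟨0, zero_mem _, ?_, Or.inl rfl⟩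
    have := neg_eq_zero.mpr (hr _ _ (Z_row a d b h'))
    rw [neg_sub] at this
    simpa [wt, Prod.Lex.toLex_lt_toLex, h', h'.not_gt] using this
  · refine ⟨0, zero_mem _, ?_, Or.inl rfl⟩
    simp [wt, h.ne, h.ne', h'.ne, h'.ne', Z_comm a b c d h h']
  · refine ⟨0, zero_mem _, ?_, Or.inl rfl⟩
    have := neg_eq_zero.mpr (hr _ _ (Z_col c a b h))
    rw [neg_sub] at this
    simpa [wt, Prod.Lex.toLex_lt_toLex, h, h.not_gt, h.ne, h.ne'] using this
  · refine ⟨_, neg_mem hq2, ?_, Or.inr (Or.inr ⟨h, h'⟩)⟩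
    simp [wt, h.ne, h.ne', h'.ne, h'.ne', Z_cross c d a b h h', Z_comm a d c b h h', ← neg_smul]

/-! ### Normalized words and reordering modulo lower terms -/

/-- The sum of the weights of the pairs of letters of a word. -/
def energy : List (Fin n × Fin n) → ℤ
  | [] => 0
  | p :: l => (l.map (wt p)).sum + energy l

lemma energy_append (l l' : List (Fin n × Fin n)) :
    energy (l ++ l') = energy l + energy l' + (l.map fun p => (l'.map (wt p)).sum).sum := by
  induction l with
  | nil => simp [energy]
  | cons p l ih =>
    simp only [List.cons_append, energy, ih, List.map_append, List.sum_append, List.map_cons,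
      List.sum_cons]
    ring

lemma energy_reverse (l : List (Fin n × Fin n)) : energy l.reverse = -energy l := by
  induction l with
  | nil => simp [energy]
  | cons p l ih =>
    have h : (l.map fun x => wt x p).sum = -(l.map (wt p)).sum := by
      rw [List.sum_neg, List.map_map]
      exact congrArg List.sum (List.map_congr_left fun x _ => wt_antisymm x p)
    rw [List.reverse_cons, energy_append, ih]
    simp [energy, h, List.sum_reverse]

/-- The normalized product of the generators along a word. -/
def normWord (l : List (Fin n × Fin n)) : O n := q ^ (-energy l) • wordProd l

/-- The span over `ℤ[q, q⁻¹]` of the words whose content is smaller than `A`. -/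
def lowerWords (A : Matrix (Fin n) (Fin n) ℕ) : Submodule Laurent (O n) :=
  Submodule.span Laurent {x | ∃ l, Prec (content l) A ∧ wordProd l = x}

lemma smul_mem_of_mem_laurent {S : Submodule Laurent (O n)} {c : K} (hc : c ∈ Laurent) {x : O n}
    (hx : x ∈ S) : c • x ∈ S :=
  S.smul_mem ⟨c, hc⟩ hx

lemma normWord_swap_sub_mem (l l' : List (Fin n × Fin n)) (p p' : Fin n × Fin n) :
    normWord (l ++ p :: p' :: l') - normWord (l ++ p' :: p :: l') ∈
      lowerWords (content (l ++ p :: p' :: l')) := by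
  obtain ⟨c, hc, hcp, h⟩ := exchange p p'
  have hq := q_ne_zero
  -- The weights of all pairs of letters other than the exchanged one, common to both words.
  let e : ℤ := -(energy l + energy l' + (l'.map (wt p)).sum + (l'.map (wt p')).sum +
    (l.map fun x => ((p :: p' :: l').map (wt x)).sum).sum)
  have h₁ : -energy (l ++ p :: p' :: l') = e + -wt p p' := by
    simp only [energy_append, energy, List.map_cons, List.sum_cons, e]
    ring
  have h₂ : -energy (l ++ p' :: p :: l') = e + -wt p' p := by
    simp only [energy_append, energy, List.map_cons, List.sum_cons, e, add_left_comm (wt _ p')]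
    ring
  have key : normWord (l ++ p :: p' :: l') - normWord (l ++ p' :: p :: l') =
      (q ^ e * c) • wordProd (l ++ (p.1, p'.2) :: (p'.1, p.2) :: l') := by
    have : wordProd l * (q ^ (-wt p p') • (Z p.1 p.2 * Z p'.1 p'.2) -
        q ^ (-wt p' p) • (Z p'.1 p'.2 * Z p.1 p.2)) * wordProd l' =
        wordProd l * (c • (Z p.1 p'.2 * Z p'.1 p.2)) * wordProd l' := by rw [hcp]
    rw [normWord, normWord, h₁, h₂, zpow_add₀ hq, zpow_add₀ hq, mul_smul, mul_smul, mul_smul,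
      ← smul_sub]
    congr 1
    simpa only [wordProd_append, wordProd_cons, mul_sub, sub_mul, mul_smul_comm, smul_mul_assoc,
      mul_assoc] using this
  rw [key]
  rcases h with rfl | h | h
  · simp
  · exact smul_mem_of_mem_laurent (mul_mem (q_zpow_mem_laurent e) hc)
      (Submodule.subset_span ⟨_, prec_exchange h.1 h.2 l l', rfl⟩)
  · refine smul_mem_of_mem_laurent (mul_mem (q_zpow_mem_laurent e) hc)
      (Submodule.subset_span ⟨_, ?_, rfl⟩)
    have := prec_exchange h.1 h.2 l l'
    rwa [content_perm ((List.Perm.swap (p.1, p'.2) (p'.1, p.2) l').append_left l),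
      content_perm ((List.Perm.swap p p' l').append_left l)] at this

lemma normWord_perm_sub_mem {l l' : List (Fin n × Fin n)} (h : l.Perm l')
    (c : List (Fin n × Fin n)) :
    normWord (c ++ l) - normWord (c ++ l') ∈ lowerWords (content (c ++ l)) := by
  induction h generalizing c with
  | nil => simp
  -- The common first letter is absorbed into the prefix.
  | cons x _ ih => simpa using ih (c ++ [x])
  | swap x y l => exact normWord_swap_sub_mem c l y x
  | trans h₁ _ ih₁ ih₂ =>
    have h₂ := ih₂ c
    rw [← content_perm (h₁.append_left c)] at h₂
    simpa using add_mem (ih₁ c) h₂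

/-- The letters of the monomial `Z^A`. -/
def word (A : Matrix (Fin n) (Fin n) ℕ) : List (Fin n × Fin n) :=
  (List.finRange n).flatMap fun i => (List.finRange n).flatMap fun j =>
    List.replicate (A i j) (i, j)

lemma wordProd_flatMap {α : Type*} (l : List α) (f : α → List (Fin n × Fin n)) :
    wordProd (l.flatMap f) = (l.map fun x => wordProd (f x)).prod := by
  induction l with
  | nil => simp [wordProd]
  | cons x l ih => simp [wordProd_append, ih]

lemma wordProd_word (A : Matrix (Fin n) (Fin n) ℕ) : wordProd (word A) = monomial A := by
  simp only [word, wordProd_flatMap, monomial]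
  simp [wordProd]

lemma content_word (A : Matrix (Fin n) (Fin n) ℕ) : content (word A) = A := by
  funext i j
  simp only [content, word, List.count_flatMap, Function.comp_def, List.count_replicate]
  rw [← List.ofFn_eq_map, List.sum_ofFn, Finset.sum_eq_single i, ← List.ofFn_eq_map, List.sum_ofFn,
    Finset.sum_eq_single j]
  all_goals simp +contextual

lemma perm_word_content (l : List (Fin n × Fin n)) : l.Perm (word (content l)) := by
  rw [List.perm_iff_count]
  rintro ⟨i, j⟩
  exact (congrFun (congrFun (content_word (content l)) i) j).symm

lemma pairwise_word (A : Matrix (Fin n) (Fin n) ℕ) :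
    (word A).Pairwise fun p p' => toLex p ≤ toLex p' := by
  refine List.pairwise_flatMap.mpr ⟨fun i _ => List.pairwise_flatMap.mpr ⟨fun j _ => ?_, ?_⟩, ?_⟩
  · simp [List.pairwise_replicate]
  · refine (List.pairwise_lt_finRange n).imp fun h x hx y hy => ?_
    rw [List.eq_of_mem_replicate hx, List.eq_of_mem_replicate hy, Prod.Lex.toLex_le_toLex]
    exact Or.inr ⟨rfl, h.le⟩
  · refine (List.pairwise_lt_finRange n).imp fun h x hx y hy => ?_
    obtain ⟨_, _, hx⟩ := List.mem_flatMap.mp hx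
    obtain ⟨_, _, hy⟩ := List.mem_flatMap.mp hy
    rw [List.eq_of_mem_replicate hx, List.eq_of_mem_replicate hy, Prod.Lex.toLex_le_toLex]
    exact Or.inl h

lemma sum_map_eq_sum_count {α M : Type*} [Fintype α] [BEq α] [LawfulBEq α] [AddCommMonoid M]
    (l : List α) (f : α → M) : (l.map f).sum = ∑ x, l.count x • f x := by
  classical
  induction l with
  | nil => simp
  | cons y l ih => simp [List.count_cons, add_smul, Finset.sum_add_distrib, ih, add_comm]

/-- The indicator function of the pairs of distinct positions in one row or column. -/
def adj (p p' : Fin n × Fin n) : ℤ :=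
  (if p.1 = p'.1 ∧ p.2 ≠ p'.2 then 1 else 0) + if p.2 = p'.2 ∧ p.1 ≠ p'.1 then 1 else 0

lemma adj_self (p : Fin n × Fin n) : adj p p = 0 := by simp [adj]

lemma adj_comm (p p' : Fin n × Fin n) : adj p p' = adj p' p := by
  simp [adj, eq_comm]

lemma wt_eq_adj {p p' : Fin n × Fin n} (h : toLex p ≤ toLex p') : wt p p' = adj p p' := by
  obtain ⟨a, b⟩ := p
  obtain ⟨c, d⟩ := p'
  rcases h.eq_or_lt with h | h
  · have : (a, b) = (c, d) := congrArg ofLex h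
    rw [this, adj_self]
    simp [wt]
  · rw [wt, if_pos h]
    rw [Prod.Lex.toLex_lt_toLex] at h
    rcases h with h | ⟨h, h'⟩
    · simp [adj, h.ne]
    · simp only at h h'
      simp [adj, h, h'.ne]

/-- In a sorted word the weight agrees with the symmetric function `adj`, which vanishes on equal
letters. Twice the energy is then a full double sum, which depends only on multiplicities. -/
lemma two_mul_energy {l : List (Fin n × Fin n)}
    (hl : l.Pairwise fun p p' => toLex p ≤ toLex p') :
    2 * energy l = (l.map fun p => (l.map (adj p)).sum).sum := by
  induction l with
  | nil => simp [energy]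
  | cons p l ih =>
    rw [List.pairwise_cons] at hl
    have h₁ : (l.map (wt p)).sum = (l.map (adj p)).sum :=
      congrArg List.sum (List.map_congr_left fun x hx => wt_eq_adj (hl.1 x hx))
    have h₂ : (l.map fun x => adj x p).sum = (l.map (adj p)).sum :=
      congrArg List.sum (List.map_congr_left fun x _ => adj_comm x p)
    rw [energy, mul_add, ih hl.2, h₁]
    simp only [List.map_cons, List.sum_cons, List.sum_map_add, h₂, adj_self]
    ring

lemma two_mul_sum_lt (a : Fin n → ℕ) :
    2 * ∑ j, ∑ k ∈ Finset.univ.filter (fun k => k < j), a j * a k =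
      ∑ j, ∑ k, if j ≠ k then a j * a k else 0 := by
  have h : ∑ j, ∑ k ∈ Finset.univ.filter (fun k => k < j), a j * a k =
      ∑ j, ∑ k ∈ Finset.univ.filter (fun k => j < k), a j * a k := by
    simp only [Finset.sum_filter]
    rw [Finset.sum_comm]
    simp only [mul_comm]
  rw [two_mul]
  nth_rewrite 2 [h]
  simp only [Finset.sum_filter, ← Finset.sum_add_distrib]
  refine Finset.sum_congr rfl fun j _ => Finset.sum_congr rfl fun k _ => ?_
  rcases lt_trichotomy j k with h | rfl | h
  · simp [h, h.not_gt, h.ne]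
  · simp
  · simp [h, h.not_gt, h.ne']

/-- This identifies D(A) as the scaling of the sorted word; both sides are doubled so as to compare
symmetric sums. -/
lemma energy_word (A : Matrix (Fin n) (Fin n) ℕ) : energy (word A) = dExp A := by
  have h₁ := two_mul_energy (pairwise_word A)
  have hc (p : Fin n × Fin n) : (word A).count p = A p.1 p.2 :=
    congrFun (congrFun (content_word A) p.1) p.2
  simp only [sum_map_eq_sum_count, hc] at h₁
  have h₂ : 2 * dExp A = (∑ i, ∑ j, ∑ k, if j ≠ k then A i j * A i k else 0) +
      ∑ i, ∑ j, ∑ k, if j ≠ k then A j i * A k i else 0 := by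
    rw [dExp, mul_add, Finset.mul_sum, Finset.mul_sum]
    congr 1
    · exact Finset.sum_congr rfl fun i _ => two_mul_sum_lt fun j => A i j
    · exact Finset.sum_congr rfl fun i _ => two_mul_sum_lt fun j => A j i
  have h₃ : (2 * dExp A : ℤ) = ∑ p : Fin n × Fin n, A p.1 p.2 • ∑ p' : Fin n × Fin n,
      A p'.1 p'.2 • adj p p' := by
    have := congrArg (Nat.cast (R := ℤ)) h₂
    push_cast at this
    rw [this]
    simp only [adj, smul_add, Finset.sum_add_distrib, Fintype.sum_prod_type, nsmul_eq_mul,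
      Finset.mul_sum, mul_ite, mul_one, mul_zero, ite_and]
    congr 1
    · simp
    · rw [Finset.sum_comm]
      simp
  lia

lemma normWord_word (A : Matrix (Fin n) (Fin n) ℕ) : normWord (word A) = normMonomial A := by
  rw [normWord, energy_word, wordProd_word, normMonomial, D]

lemma normWord_sub_mem (l : List (Fin n × Fin n)) :
    normWord l - normMonomial (content l) ∈ lowerWords (content l) := by
  rw [← normWord_word]
  exact normWord_perm_sub_mem (perm_word_content l) []

/-! ### Triangularity of the bar involution -/

/-- The span over `ℤ[q, q⁻¹]` of the normalized monomials smaller than `Z(A)`. -/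
def lowerMonomials (A : Matrix (Fin n) (Fin n) ℕ) : Submodule Laurent (O n) :=
  Submodule.span Laurent (normMonomial '' {B | Prec B A})

/-- A normalized word is the normalized monomial of its content plus still lower words, which are
covered by well-founded induction. -/
lemma lowerWords_le (A : Matrix (Fin n) (Fin n) ℕ) : lowerWords A ≤ lowerMonomials A := by
  induction A using wellFounded_prec.induction with
  | _ A ih =>
    refine Submodule.span_le.mpr ?_
    rintro _ ⟨l, hl, rfl⟩
    have h₁ : normMonomial (content l) ∈ lowerMonomials A := Submodule.subset_span ⟨_, hl, rfl⟩
    have h₂ : lowerMonomials (content l) ≤ lowerMonomials A :=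
      Submodule.span_mono (Set.image_mono fun B hB => hB.trans hl)
    have h₃ : normWord l ∈ lowerMonomials A := by
      simpa using add_mem (h₂ (ih _ hl (normWord_sub_mem l))) h₁
    have h₄ : wordProd l = q ^ energy l • normWord l := by
      rw [normWord, smul_smul, ← zpow_add₀ q_ne_zero, add_neg_cancel, zpow_zero, one_smul]
    rw [SetLike.mem_coe, h₄]
    exact smul_mem_of_mem_laurent (q_zpow_mem_laurent _) h₃

lemma bar_wordProd (l : List (Fin n × Fin n)) : bar (wordProd l) = wordProd l.reverse := by
  induction l with
  | nil => simp [wordProd, bar_one]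
  | cons p l ih =>
    rw [wordProd_cons, bar_mul, ih, bar_Z, List.reverse_cons, wordProd_append, wordProd_cons]
    simp [wordProd]

lemma bar_normWord (l : List (Fin n × Fin n)) : bar (normWord l) = normWord l.reverse := by
  rw [normWord, bar_smul, bar_wordProd, normWord, energy_reverse, map_zpow₀, barK_q, inv_zpow,
    zpow_neg, zpow_neg, inv_inv, zpow_neg, inv_inv]

lemma bar_bar_normMonomial (A : Matrix (Fin n) (Fin n) ℕ) :
    bar (bar (normMonomial A)) = normMonomial A := by
  rw [← normWord_word, bar_normWord, bar_normWord, List.reverse_reverse]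

theorem bar_normMonomial_sub_mem (A : Matrix (Fin n) (Fin n) ℕ) :
    bar (normMonomial A) - normMonomial A ∈ lowerMonomials A := by
  have h := normWord_sub_mem (word A).reverse
  rw [content_perm (List.reverse_perm _), content_word] at h
  rw [← normWord_word, bar_normWord, normWord_word]
  exact lowerWords_le A h

/-! ### Laurent polynomials and their bar involution -/

/-- The evaluation of integer polynomials at `q`. -/
def evalQ : Polynomial ℤ →+* K :=
  (algebraMap (Polynomial ℚ) K).comp (Polynomial.mapRingHom (Int.castRingHom ℚ))

lemma evalQ_injective : Function.Injective evalQ :=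
  (RatFunc.algebraMap_injective ℚ).comp (Polynomial.map_injective _ Int.cast_injective)

lemma evalQ_X : evalQ Polynomial.X = q := by
  simp [evalQ]

lemma evalQ_eq (p : Polynomial ℤ) : evalQ p = p.eval₂ (Int.castRingHom K) q := by
  have : evalQ = Polynomial.eval₂RingHom (Int.castRingHom K) q :=
    Polynomial.ringHom_ext (by simp) (by simp [evalQ_X])
  rw [this]
  rfl

lemma exists_evalQ {x : K} (hx : x ∈ Zq) : ∃ p, evalQ p = x := by
  induction hx using Algebra.adjoin_induction with
  | mem x hx =>
    obtain rfl : x = q := hx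
    exact ⟨Polynomial.X, evalQ_X⟩
  | algebraMap m => exact ⟨(m : Polynomial ℤ), by simp⟩
  | add x y _ _ hx hy =>
    obtain ⟨a, rfl⟩ := hx
    obtain ⟨b, rfl⟩ := hy
    exact ⟨a + b, map_add _ _ _⟩
  | mul x y _ _ hx hy =>
    obtain ⟨a, rfl⟩ := hx
    obtain ⟨b, rfl⟩ := hy
    exact ⟨a * b, map_mul _ _ _⟩

lemma barK_evalQ (p : Polynomial ℤ) :
    barK (evalQ p) = p.eval₂ (Int.castRingHom K) q⁻¹ := by
  rw [evalQ_eq, Polynomial.hom_eval₂, barK_q]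
  congr 1
  exact RingHom.ext_int _ _

/-- A polynomial in `q` without constant term that is a polynomial in `q⁻¹` vanishes. -/
lemma eq_zero_of_mul_eq_barK {a b : K} (ha : a ∈ Zq) (hb : b ∈ Zq) (h : q * a = barK b) :
    a = 0 := by
  obtain ⟨p, rfl⟩ := exists_evalQ ha
  obtain ⟨s, rfl⟩ := exists_evalQ hb
  have hq := q_ne_zero
  rw [barK_evalQ] at h
  have hs : evalQ s.reverse = s.eval₂ (Int.castRingHom K) q⁻¹ * q ^ s.natDegree := by
    let := invertibleOfNonzero (inv_ne_zero hq)
    have := Polynomial.eval₂_reverse_mul_pow (Int.castRingHom K) (q⁻¹ : K) s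
    rw [invOf_eq_inv, inv_inv] at this
    rw [evalQ_eq, ← this, mul_assoc, ← mul_pow, inv_mul_cancel₀ hq, one_pow, mul_one]
  -- Clearing denominators turns s(q⁻¹) into the reversed polynomial, of degree at most deg s,
  -- whereas the left side has degree above deg s unless `p = 0`.
  have hp : Polynomial.X ^ (s.natDegree + 1) * p = s.reverse := by
    refine evalQ_injective ?_
    rw [hs, ← h, map_mul, map_pow, evalQ_X]
    ring
  by_contra hne
  have hp0 : p ≠ 0 := by
    rintro rfl
    simp at hne
  have hd := congrArg Polynomial.natDegree hp
  rw [Polynomial.natDegree_X_pow_mul _ hp0] at hd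
  have := Polynomial.reverse_natDegree_le s
  omega

lemma barK_laurent {c : K} (hc : c ∈ Laurent) : barK c ∈ Laurent := by
  induction hc using Algebra.adjoin_induction with
  | mem x hx =>
    rcases hx with rfl | rfl
    · rw [barK_q]
      exact q_inv_mem_laurent
    · rw [map_inv₀, barK_q, inv_inv]
      exact q_mem_laurent
  | algebraMap m =>
    rw [eq_intCast, map_intCast]
    exact intCast_mem _ m
  | add x y _ _ hx hy => rw [map_add]; exact add_mem hx hy
  | mul x y _ _ hx hy => rw [map_mul]; exact mul_mem hx hy

lemma barK_barK {c : K} (hc : c ∈ Laurent) : barK (barK c) = c := by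
  induction hc using Algebra.adjoin_induction with
  | mem x hx =>
    rcases hx with rfl | rfl <;> simp [barK_q]
  | algebraMap m => simp
  | add x y _ _ hx hy => simp only [map_add, hx, hy]
  | mul x y _ _ hx hy => simp only [map_mul, hx, hy]

lemma Zq_le_laurent : Zq ≤ Laurent := Algebra.adjoin_mono (by simp)

lemma q_mul_mem_laurent {p : K} (hp : p ∈ Zq) : q * p ∈ Laurent :=
  mul_mem q_mem_laurent (Zq_le_laurent hp)

lemma q_mem_Zq : (q : K) ∈ Zq := Algebra.subset_adjoin rfl

/-- The element is the sum of a polynomial in `q` and one in `q⁻¹`, both without constant term, and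
an integer. -/
def HasDecomposition (c : K) : Prop :=
  ∃ a ∈ Zq, ∃ b ∈ Zq, ∃ m : ℤ, c = q * a + m + barK (q * b)

lemma HasDecomposition.add {c d : K} (hc : HasDecomposition c) (hd : HasDecomposition d) :
    HasDecomposition (c + d) := by
  obtain ⟨a, ha, b, hb, m, rfl⟩ := hc
  obtain ⟨a', ha', b', hb', m', rfl⟩ := hd
  refine ⟨a + a', add_mem ha ha', b + b', add_mem hb hb', m + m', ?_⟩
  simp only [map_mul, map_add, Int.cast_add]
  ring

lemma hasDecomposition_zpow (m k : ℤ) : HasDecomposition (m * q ^ k) := by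
  rcases lt_trichotomy k 0 with h | rfl | h
  · obtain ⟨k, rfl⟩ : ∃ l : ℕ, k = -((l : ℤ) + 1) := ⟨(-k - 1).toNat, by omega⟩
    refine ⟨0, zero_mem _, m * q ^ k, mul_mem (intCast_mem _ m) (pow_mem q_mem_Zq k), 0, ?_⟩
    rw [map_mul, map_mul, map_pow, barK_q, map_intCast, zpow_neg, ← Int.natCast_succ,
      zpow_natCast, pow_succ]
    simp
    ring
  · exact ⟨0, zero_mem _, 0, zero_mem _, m, by simp⟩
  · obtain ⟨k, rfl⟩ : ∃ l : ℕ, k = (l : ℤ) + 1 := ⟨(k - 1).toNat, by omega⟩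
    refine ⟨m * q ^ k, mul_mem (intCast_mem _ m) (pow_mem q_mem_Zq k), 0, zero_mem _, 0, ?_⟩
    rw [← Int.natCast_succ, zpow_natCast, pow_succ']
    simp
    ring

lemma exists_zpow_mul_evalQ {c : K} (hc : c ∈ Laurent) :
    ∃ (k : ℕ) (p : Polynomial ℤ), c = q ^ (-(k : ℤ)) * evalQ p := by
  have hq := q_ne_zero
  induction hc using Algebra.adjoin_induction with
  | mem x hx =>
    rcases hx with rfl | rfl
    · exact ⟨0, Polynomial.X, by simp [evalQ_X]⟩
    · exact ⟨1, 1, by simp⟩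
  | algebraMap m => exact ⟨0, (m : Polynomial ℤ), by simp⟩
  | add x y _ _ hx hy =>
    obtain ⟨k, a, rfl⟩ := hx
    obtain ⟨l, b, rfl⟩ := hy
    refine ⟨k + l, Polynomial.X ^ l * a + Polynomial.X ^ k * b, ?_⟩
    simp only [map_add, map_mul, map_pow, evalQ_X, zpow_neg, zpow_natCast, pow_add]
    field_simp
  | mul x y _ _ hx hy =>
    obtain ⟨k, a, rfl⟩ := hx
    obtain ⟨l, b, rfl⟩ := hy
    refine ⟨k + l, a * b, ?_⟩
    simp only [map_mul, zpow_neg, zpow_natCast, pow_add]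
    field_simp

lemma hasDecomposition_of_mem {c : K} (hc : c ∈ Laurent) : HasDecomposition c := by
  obtain ⟨k, p, rfl⟩ := exists_zpow_mul_evalQ hc
  clear hc
  induction p using Polynomial.induction_on' with
  | add a b ha hb =>
    rw [map_add, mul_add]
    exact ha.add hb
  | monomial j m =>
    have : q ^ (-(k : ℤ)) * evalQ (Polynomial.monomial j m) = m * q ^ (-(k : ℤ) + j) := by
      rw [evalQ_eq, Polynomial.eval₂_monomial, zpow_add₀ q_ne_zero, zpow_natCast, eq_intCast]
      ring
    rw [this]
    exact hasDecomposition_zpow m _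

/-- Write c = qa + m + bar(qb). Antisymmetry makes q(a + b) a polynomial in q⁻¹, so b = −a, and then
2m = 0. -/
lemma exists_eq_sub_barK {c : K} (hc : c ∈ Laurent) (h : barK c = -c) :
    ∃ p ∈ Zq, c = q * p - barK (q * p) := by
  obtain ⟨a, ha, b, hb, m, rfl⟩ := hasDecomposition_of_mem hc
  rw [map_add, map_add, barK_barK (q_mul_mem_laurent hb), map_intCast] at h
  have key : q * (a + b) = barK (-(q * (a + b)) - (2 * m : ℤ)) := by
    rw [map_sub, map_neg, mul_add, map_add, map_intCast]
    push_cast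
    linear_combination h
  have hab := eq_zero_of_mul_eq_barK (add_mem ha hb)
    (sub_mem (neg_mem (mul_mem q_mem_Zq (add_mem ha hb))) (intCast_mem _ _)) key
  have hm : (m : K) = 0 := by
    rw [hab] at key
    simpa using key
  refine ⟨a, ha, ?_⟩
  rw [hm, eq_neg_of_add_eq_zero_right hab]
  simp [sub_eq_add_neg]

/-! ### Existence and uniqueness of the invariant elements -/

lemma bar_zero : bar (0 : O n) = 0 := (AddMonoidHom.mk' bar bar_add).map_zero

lemma bar_sub (x y : O n) : bar (x - y) = bar x - bar y :=
  (AddMonoidHom.mk' bar bar_add).map_sub x y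

lemma lowerMonomials_le {S : Set (Matrix (Fin n) (Fin n) ℕ)} {A : Matrix (Fin n) (Fin n) ℕ}
    (hS : ∀ B, Prec B A → B ∈ S) :
    lowerMonomials A ≤ Submodule.span Laurent (normMonomial '' S) :=
  Submodule.span_mono (Set.image_mono hS)

lemma bar_mem_span {S : Set (Matrix (Fin n) (Fin n) ℕ)}
    (hS : ∀ A ∈ S, ∀ B, Prec B A → B ∈ S) {y : O n}
    (hy : y ∈ Submodule.span Laurent (normMonomial '' S)) :
    bar y ∈ Submodule.span Laurent (normMonomial '' S) := by
  induction hy using Submodule.span_induction with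
  | mem x hx =>
    obtain ⟨A, hA, rfl⟩ := hx
    have := lowerMonomials_le (hS A hA) (bar_normMonomial_sub_mem A)
    simpa using add_mem this (Submodule.subset_span ⟨A, hA, rfl⟩)
  | zero => rw [bar_zero]; exact zero_mem _
  | add x y _ _ hx hy => rw [bar_add]; exact add_mem hx hy
  | smul c x _ hx =>
    rw [Subalgebra.smul_def, bar_smul]
    exact smul_mem_of_mem_laurent (barK_laurent c.2) hx

lemma span_laurent_le (S : Set (O n)) {x : O n} (hx : x ∈ Submodule.span Laurent S) :
    x ∈ Submodule.span K S :=
  Submodule.span_le_restrictScalars Laurent K S hx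

lemma coeff_eq_zero {S : Set (Matrix (Fin n) (Fin n) ℕ)} {A : Matrix (Fin n) (Fin n) ℕ}
    (hA : A ∉ S) {c : K} {w : O n} (hw : w ∈ Submodule.span K (normMonomial '' S))
    (h : c • normMonomial A + w = 0) : c = 0 := by
  by_contra hc
  refine (linearIndependent_normMonomial n).notMem_span_image hA ?_
  have : normMonomial A = -(c⁻¹ • w) := by
    rw [eq_neg_iff_add_eq_zero, ← smul_right_injective _ hc |>.eq_iff]
    simpa [smul_smul, hc] using h
  rw [this]
  exact neg_mem (Submodule.smul_mem _ _ hw)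

/-- The linear combination of the normalized monomials with given coefficients. -/
def comb (n : ℕ) : (Matrix (Fin n) (Fin n) ℕ →₀ K) →ₗ[K] O n :=
  Finsupp.linearCombination K normMonomial

lemma comb_single (A : Matrix (Fin n) (Fin n) ℕ) (c : K) :
    comb n (Finsupp.single A c) = c • normMonomial A := by
  simp [comb]

lemma comb_mem_span {S : Set (Matrix (Fin n) (Fin n) ℕ)} {h : Matrix (Fin n) (Fin n) ℕ →₀ K}
    (hh : ∀ B, h B ∈ Laurent) (hS : ∀ B ∈ h.support, B ∈ S) :
    comb n h ∈ Submodule.span Laurent (normMonomial '' S) :=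
  Submodule.sum_mem _ fun B hB =>
    smul_mem_of_mem_laurent (hh B) (Submodule.subset_span ⟨B, hS B hB, rfl⟩)

/-- The lexicographically largest `A` in `S` is peeled off: by triangularity its coefficient in `y`
is itself anti-invariant, hence of the form qp − bar(qp), and qp is the coefficient of `h` at `A`.
-/
lemma exists_eq_comb_sub_bar (S : Finset (Matrix (Fin n) (Fin n) ℕ))
    (hS : ∀ A ∈ S, ∀ B, Prec B A → B ∈ S) (y : O n)
    (hy : y ∈ Submodule.span Laurent (normMonomial '' (S : Set (Matrix (Fin n) (Fin n) ℕ))))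
    (hbar : bar y = -y) :
    ∃ h : Matrix (Fin n) (Fin n) ℕ →₀ K, (∀ B, ∃ p ∈ Zq, h B = q * p) ∧
      (∀ B ∈ h.support, B ∈ S) ∧ y = comb n h - bar (comb n h) := by
  classical
  induction S using Finset.strongInduction generalizing y with
  | H S ih =>
    rcases S.eq_empty_or_nonempty with rfl | hne
    · refine ⟨0, fun _ => ⟨0, zero_mem _, by simp⟩, by simp, ?_⟩
      simpa [bar_zero] using hy
    obtain ⟨A, hA, hmax⟩ := S.exists_max_image entries hne
    have hS' : ∀ C ∈ S.erase A, ∀ B, Prec B C → B ∈ S.erase A := by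
      intro C hC B hB
      have hC' := Finset.mem_of_mem_erase hC
      refine Finset.mem_erase.mpr ⟨?_, hS C hC' B hB⟩
      rintro rfl
      exact (hmax C hC').not_gt hB.1
    have hA' : ∀ B, Prec B A → B ∈ ((S.erase A : Finset _) : Set (Matrix (Fin n) (Fin n) ℕ)) :=
      fun B hB => Finset.mem_coe.mpr
        (Finset.mem_erase.mpr ⟨fun h => not_prec_self A (h ▸ hB), hS A hA B hB⟩)
    have hAmem := lowerMonomials_le hA' (bar_normMonomial_sub_mem A)
    rw [← Finset.insert_erase hA, Finset.coe_insert, Set.image_insert_eq,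
      Submodule.mem_span_insert] at hy
    obtain ⟨⟨c, hc⟩, y', hy', rfl⟩ := hy
    rw [Subalgebra.smul_def] at hbar
    simp only at hbar
    have hcbar : barK c + c = 0 := by
      refine coeff_eq_zero (S := ((S.erase A : Finset _) : Set (Matrix (Fin n) (Fin n) ℕ)))
        (A := A) (by simp) (span_laurent_le _ (add_mem (add_mem (bar_mem_span hS' hy') hy')
          (smul_mem_of_mem_laurent (barK_laurent hc) hAmem))) ?_
      rw [bar_add, bar_smul] at hbar
      rw [smul_sub, add_smul]
      linear_combination (norm := abel) hbar
    obtain ⟨p, hp, hcp⟩ := exists_eq_sub_barK hc (eq_neg_of_add_eq_zero_left hcbar)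
    have hg := q_mul_mem_laurent hp
    -- The new element is y − (qp Z(A) − bar(qp) bar Z(A)): it is again anti-invariant, and Z(A) no
    -- longer occurs in it.
    obtain ⟨h, h₁, h₂, h₃⟩ := ih (S.erase A) (Finset.erase_ssubset hA) hS'
      (y' + barK (q * p) • (bar (normMonomial A) - normMonomial A))
      (add_mem hy' (smul_mem_of_mem_laurent (barK_laurent hg) hAmem)) (by
        rw [bar_add, bar_smul] at hbar
        rw [bar_add, bar_smul, barK_barK hg, bar_sub, bar_bar_normMonomial]
        rw [hcp, map_sub, barK_barK hg] at hbar
        linear_combination (norm := (simp only [smul_sub, sub_smul]; abel)) hbar)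
    refine ⟨h + Finsupp.single A (q * p), fun B => ?_, fun B hB => ?_, ?_⟩
    · obtain ⟨p', hp', hB⟩ := h₁ B
      rw [Finsupp.add_apply, hB, Finsupp.single_apply]
      split_ifs
      · exact ⟨p' + p, add_mem hp' hp, by ring⟩
      · exact ⟨p', hp', by ring⟩
    · rcases Finset.mem_union.mp (Finsupp.support_add hB) with hB | hB
      · exact Finset.mem_of_mem_erase (h₂ B hB)
      · rw [Finset.mem_singleton.mp (Finsupp.support_single_subset hB)]
        exact hA
    · rw [map_add, comb_single, bar_add, bar_smul, Subalgebra.smul_def]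
      simp only
      rw [hcp]
      linear_combination (norm := (simp only [smul_sub, sub_smul]; abel)) h₃

lemma hasLeadingTerm_iff {A : Matrix (Fin n) (Fin n) ℕ} {x : O n} : HasLeadingTerm A x ↔
    ∃ h : Matrix (Fin n) (Fin n) ℕ →₀ K, (∀ B, ∃ p ∈ Zq, h B = q * p) ∧
      (∀ B ∈ h.support, Prec B A) ∧ x = normMonomial A + comb n h := Iff.rfl

/-- Invariance of Z(A) + w means bar Z(A) − Z(A) = w − bar w, and the left side is anti-invariant
because applying bar twice fixes Z(A). -/
theorem exists_canonical (A : Matrix (Fin n) (Fin n) ℕ) :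
    ∃ x : O n, bar x = x ∧ HasLeadingTerm A x := by
  obtain ⟨h, h₁, h₂, h₃⟩ := exists_eq_comb_sub_bar (finite_prec A).toFinset
    (fun B hB C hC => by
      rw [Set.Finite.mem_toFinset] at hB ⊢
      exact hC.trans hB)
    (bar (normMonomial A) - normMonomial A)
    (by rw [Set.Finite.coe_toFinset]; exact bar_normMonomial_sub_mem A)
    (by rw [bar_sub, bar_bar_normMonomial, neg_sub])
  refine ⟨normMonomial A + comb n h, ?_, hasLeadingTerm_iff.mpr ⟨h, h₁, fun B hB => ?_, rfl⟩⟩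
  · rw [bar_add]
    linear_combination (norm := abel) h₃
  · simpa using h₂ B hB

/-- By triangularity, the coefficient at the largest matrix of the support is fixed by `barK`, hence
lies in both qℤ[q] and ℤ[q⁻¹] and vanishes. -/
lemma eq_zero_of_bar_comb {h : Matrix (Fin n) (Fin n) ℕ →₀ K} (h₁ : ∀ B, ∃ p ∈ Zq, h B = q * p)
    (hbar : bar (comb n h) = comb n h) : h = 0 := by
  classical
  by_contra hne
  obtain ⟨A, hA, hmax⟩ := h.support.exists_max_image entries (Finsupp.support_nonempty_iff.mpr hne)
  -- The support may mix different row and column sums, so the total lexicographic order is used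
  -- instead of `Prec`.
  let S : Set (Matrix (Fin n) (Fin n) ℕ) := {B | entries B < entries A}
  have hS : ∀ B ∈ S, ∀ C, Prec C B → C ∈ S := fun B hB C hC => lt_trans hC.1 hB
  have hmem := lowerMonomials_le (S := S) (fun B hB => hB.1) (bar_normMonomial_sub_mem A)
  have hL : ∀ B, h B ∈ Laurent := fun B => by
    obtain ⟨p, hp, hB⟩ := h₁ B
    rw [hB]
    exact q_mul_mem_laurent hp
  have hw : comb n (h.erase A) ∈ Submodule.span Laurent (normMonomial '' S) := by
    refine comb_mem_span (fun B => ?_) fun B hB => ?_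
    · rw [Finsupp.erase_apply]
      split_ifs
      exacts [zero_mem _, hL B]
    · rw [Finsupp.support_erase] at hB
      obtain ⟨hBA, hB⟩ := Finset.mem_erase.mp hB
      refine lt_of_le_of_ne (hmax B hB) fun h => hBA ?_
      exact funext fun i => funext fun j => congrFun (congrArg ofLex h) (toLex (i, j))
  rw [← Finsupp.single_add_erase A h, map_add, comb_single, bar_add, bar_smul] at hbar
  have hc : barK (h A) - h A = 0 := by
    refine coeff_eq_zero (S := S) (A := A) (lt_irrefl (entries A)) (span_laurent_le _ (add_mem
      (sub_mem (bar_mem_span hS hw) hw)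
      (smul_mem_of_mem_laurent (barK_laurent (hL A)) hmem))) ?_
    linear_combination (norm := (simp only [smul_sub, sub_smul]; abel)) hbar
  obtain ⟨p, hp, hAp⟩ := h₁ A
  rw [hAp, sub_eq_zero] at hc
  have := eq_zero_of_mul_eq_barK hp (mul_mem q_mem_Zq hp) hc.symm
  rw [this, mul_zero] at hAp
  exact Finsupp.mem_support_iff.mp hA hAp

theorem canonical_unique {A : Matrix (Fin n) (Fin n) ℕ} {x y : O n} (hx : bar x = x)
    (hx' : HasLeadingTerm A x) (hy : bar y = y) (hy' : HasLeadingTerm A y) : x = y := by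
  obtain ⟨h, h₁, -, rfl⟩ := hasLeadingTerm_iff.mp hx'
  obtain ⟨g, g₁, -, rfl⟩ := hasLeadingTerm_iff.mp hy'
  have key : h - g = 0 := by
    refine eq_zero_of_bar_comb (fun B => ?_) ?_
    · obtain ⟨p, hp, hB⟩ := h₁ B
      obtain ⟨p', hp', hB'⟩ := g₁ B
      exact ⟨p - p', sub_mem hp hp', by rw [Finsupp.sub_apply, hB, hB', mul_sub]⟩
    · have : comb n (h - g) = (normMonomial A + comb n h) - (normMonomial A + comb n g) := by
        rw [map_sub]
        abel
      rw [this, bar_sub, hx, hy]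
  rw [sub_eq_zero.mp key]

lemma linearIndependent_of_hasLeadingTerm {b : Matrix (Fin n) (Fin n) ℕ → O n}
    (hb : ∀ A, HasLeadingTerm A (b A)) : LinearIndependent K b := by
  classical
  rw [linearIndependent_iff]
  intro c hc
  by_contra hne
  obtain ⟨A, hA, hmax⟩ := c.support.exists_max_image entries (Finsupp.support_nonempty_iff.mpr hne)
  let S : Set (Matrix (Fin n) (Fin n) ℕ) := {B | entries B < entries A}
  have hlow : ∀ B, entries B ≤ entries A →
      b B - normMonomial B ∈ Submodule.span K (normMonomial '' S) := by
    intro B hBA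
    obtain ⟨h, -, h₂, hB⟩ := hasLeadingTerm_iff.mp (hb B)
    rw [hB, add_sub_cancel_left]
    exact Submodule.sum_mem _ fun C hC => Submodule.smul_mem _ _
      (Submodule.subset_span ⟨C, (h₂ C hC).1.trans_le hBA, rfl⟩)
  have hw : Finsupp.linearCombination K b (c.erase A) ∈ Submodule.span K (normMonomial '' S) := by
    refine Submodule.sum_mem _ fun B hB => Submodule.smul_mem _ _ ?_
    rw [Finsupp.support_erase] at hB
    obtain ⟨hBA, hB⟩ := Finset.mem_erase.mp hB
    have hlt : B ∈ S := lt_of_le_of_ne (hmax B hB) fun h => hBA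
      (funext fun i => funext fun j => congrFun (congrArg ofLex h) (toLex (i, j)))
    simpa using add_mem (hlow B (hmax B hB)) (Submodule.subset_span ⟨B, hlt, rfl⟩)
  rw [← Finsupp.single_add_erase A c, map_add, Finsupp.linearCombination_single] at hc
  refine Finsupp.mem_support_iff.mp hA (coeff_eq_zero (S := S) (A := A) (lt_irrefl (entries A))
    (add_mem (Submodule.smul_mem _ (c A) (hlow A le_rfl)) hw) ?_)
  linear_combination (norm := (simp only [smul_sub]; abel)) hc

lemma linearIndependent_Zq {ι : Type*} {b : ι → O n} (hb : LinearIndependent K b) :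
    LinearIndependent Zq b := by
  refine hb.restrict_scalars fun x y hxy => ?_
  simpa [Subalgebra.smul_def] using hxy

/-- The transition matrix is unitriangular over ℤ[q]; well-founded induction along `Prec` inverts
it. -/
lemma span_of_hasLeadingTerm {b : Matrix (Fin n) (Fin n) ℕ → O n}
    (hb : ∀ A, HasLeadingTerm A (b A)) : Submodule.span Zq (Set.range b) = lattice n := by
  have hcomb {h : Matrix (Fin n) (Fin n) ℕ →₀ K} (h₁ : ∀ B, ∃ p ∈ Zq, h B = q * p)
      {S : Submodule Zq (O n)} (hS : ∀ B ∈ h.support, normMonomial B ∈ S) : comb n h ∈ S := by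
    refine Submodule.sum_mem _ fun B hB => ?_
    obtain ⟨p, hp, hB'⟩ := h₁ B
    have : h B ∈ Zq := hB' ▸ mul_mem q_mem_Zq hp
    exact S.smul_mem ⟨h B, this⟩ (hS B hB)
  apply le_antisymm <;> rw [lattice, Submodule.span_le]
  · rintro _ ⟨A, rfl⟩
    obtain ⟨h, h₁, h₂, hA⟩ := hasLeadingTerm_iff.mp (hb A)
    rw [hA]
    exact add_mem (Submodule.subset_span ⟨A, rfl⟩)
      (hcomb h₁ fun B _ => Submodule.subset_span ⟨B, rfl⟩)
  · rintro _ ⟨A, rfl⟩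
    induction A using wellFounded_prec.induction with
    | _ A ih =>
      obtain ⟨h, h₁, h₂, hA⟩ := hasLeadingTerm_iff.mp (hb A)
      rw [← sub_eq_iff_eq_add] at hA
      rw [SetLike.mem_coe, ← hA]
      exact sub_mem (Submodule.subset_span ⟨A, rfl⟩) (hcomb h₁ fun B hB => ih B (h₂ B hB))

end QuantumMatrix

end

theorem theorem3p2 (n : ℕ) :
    LinearIndependent QuantumMatrix.Zq
      (fun A : Matrix (Fin n) (Fin n) ℕ => QuantumMatrix.normMonomial A) ∧
    ∃! b : Module.Basis (Matrix (Fin n) (Fin n) ℕ) QuantumMatrix.Zq (QuantumMatrix.lattice n),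
      ∀ A : Matrix (Fin n) (Fin n) ℕ,
        QuantumMatrix.bar (b A : QuantumMatrix.O n) = (b A : QuantumMatrix.O n) ∧
        QuantumMatrix.HasLeadingTerm A (b A : QuantumMatrix.O n) := by
  open QuantumMatrix in
  refine ⟨linearIndependent_Zq (linearIndependent_normMonomial n), ?_⟩
  choose b hbar hlead using fun A : Matrix (Fin n) (Fin n) ℕ => exists_canonical A
  have hli := linearIndependent_Zq (linearIndependent_of_hasLeadingTerm hlead)
  have hb (A) : (((Module.Basis.span hli).map
      (LinearEquiv.ofEq _ _ (span_of_hasLeadingTerm hlead))) A : O n) = b A := by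
    simp [Module.Basis.span_apply]
  refine ⟨(Module.Basis.span hli).map (LinearEquiv.ofEq _ _ (span_of_hasLeadingTerm hlead)),
    fun A => ?_, fun b' hb' => Module.Basis.eq_of_apply_eq fun A => Subtype.ext ?_⟩
  · rw [hb]
    exact ⟨hbar A, hlead A⟩
  · rw [hb]
    exact canonical_unique (hb' A).1 (hb' A).2 (hbar A) (hlead A)
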